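/- \textbf{Setting.} Let $G=(V,E)$ be a directed graph, $n=|V|\ge 1$, $m=|E|$. In the triggering model each node $v$ has a random triggering set $\mathbb T(v)$, drawn, independently over the nodes, from a given distribution on the sets of in-neighbors of $v$. The live-edge graph $L$ has the edges $(u,v)$ with $u\in\mathbb T(v)$; $\Gamma(L,S)$ is the set of nodes reachable from $S$ in $L$; the influence spread is $\sigma(S)=\mathbb E_L|\Gamma(L,S)|$. The Shapley centrality of $v$ is the Shapley value $\psi_v=\frac1{n!}\sum_\pi\big(\sigma(S_{\pi,v}\cup\{v\})-\sigma(S_{\pi,v})\big)$, where $\pi$ runs over the orderings of $V$ and $S_{\pi,v}$ is the set of nodes preceding $v$ in $\pi$. Let $\psi^{(k)}$ be the $k$-th largest of the values $\psi_v$. A random RR set $R$ is generated thus: start with $R=\{v\}$ for a uniformly random root $v$; while some $u\in R$ has no triggering set yet, draw a fresh $\mathbb T(u)$ and add it to $R$. \textbf{Algorithm ASV-RR} (parameters $\varepsilon>0$, $\ell>0$, $k\in\{1,\dots,n\}$). \emph{Phase 1.} Put $LB=1$, $\varepsilon'=\sqrt2\,\varepsilon$, $\theta_0=0$, and $est_v=0$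 for all $v$. For $i=1,\dots,\lfloor\log_2 n\rfloor-1$: let $x=n/2^i$ and $\theta_i=\Big\lceil \frac{n((\ell+1)\ln n+\ln\log_2 n+\ln 2)(2+\frac23\varepsilon')}{\varepsilon'^2x}\Big\rceil$; generate $\theta_i-\theta_{i-1}$ independent new random RR sets $R$, and for each add $1/|R|$ to $est_u$ for all $u\in R$; let $est^{(k)}$ be the $k$-th largest of the $est_v$; if $n\,est^{(k)}/\theta_i\ge(1+\varepsilon')x$, put $LB=n\,est^{(k)}/(\theta_i(1+\varepsilon'))$ and leave the loop. \emph{Phase 2.} Put $\theta=\Big\lceil\frac{n((\ell+1)\ln n+\ln4)(2+\frac23\varepsilon)}{\varepsilon^2LB}\Big\rceil$, reset $est_v=0$ for all $v$, generate $\theta$ independent new random RR sets $R$, and for each add $1/|R|$ to $est_u$ for all $u\in R$. Return $\hat\psi_v=n\,est_v/\theta$ for all $v\in V$. \textbf{Running time.} Drawing $\mathbb T(v)$ takes a time $d(v)\ge0$. Every other elementary operation takes one unit: choosing a root, one unit per processed node and per node of each drawn triggering set, one unit per updated estimate, and one unit per loop step, evaluation of a formula and test. The estimates are kept in a table of the nodes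 with nonzero estimate, so that a reset takes one unit, and finding the $k$-th largest estimate, or returning the result, takes one unit plus one unit per stored node. \textbf{Theorem.} For all $\varepsilon>0$, $\ell>0$ and $k\in\{1,\dots,n\}$, the estimates $\hat\psi_v$ returned by ASV-RR satisfy (a) unbiasedness: $\mathbb E[\hat\psi_v]=\psi_v$ for all $v\in V$; (b) absolute normalization: $\sum_{v\in V}\hat\psi_v=n$ in every run; (c) robustness: if $\psi^{(k)}\ge1$, then with probability at least $1-n^{-\ell}$ we have, simultaneously, $|\hat\psi_v-\psi_v|\le\varepsilon\psi_v$ for all $v$ with $\psi_v>\psi^{(k)}$, and $|\hat\psi_v-\psi_v|\le\varepsilon\psi^{(k)}$ for all $v$ with $\psi_v\le\psi^{(k)}$. Moreover, assume that drawing a triggering set takes time (at most) proportional to the in-degree, $d(v)\le c\cdot\mathrm{indeg}(v)$ for all $v$, that $n\ge2$ and $m\ge1$, and that $\ell\ge(\log_2k-\log_2\log_2n)/\log_2n$. Then the expected running time of ASV-RR is $$O\!\left(\frac{\ell\,(m+n)\log n\cdot\mathbb E[\sigma(\{\tilde v\})]}{\psi^{(k)}\varepsilon^2}\right),$$ where $\tilde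 v$ is a random node drawn with probability proportional to its in-degree. Here the constant in $O(\cdot)$ is uniform for $\varepsilon$ bounded above and $\ell$ bounded away from $0$: for all $c,\varepsilon_0,\ell_0>0$ there is $C>0$, depending only on $c,\varepsilon_0,\ell_0$, such that the bound holds with the constant $C$ for all such graphs, triggering distributions and drawing times, all $k$, all $0<\varepsilon\le\varepsilon_0$ and all $\ell\ge\ell_0$. -/

import Mathlib

open scoped NNReal ENNReal

noncomputable section

/-! ### The triggering model, influence spread and Shapley centrality -/

/-- An influence instance of the triggering model on the node set `V = Fin n`: a directed graph with
edge set `E`, and for every node `v` a probability distribution `trig v` of its random triggering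
set, which is a set of in-neighbors of `v`. -/
structure TriggeringModel (n : ℕ) where
  /-- The edges `(u, v)`, directed from `u` to `v`. -/
  E : Finset (Fin n × Fin n)
  /-- The distribution of the triggering set of a node. -/
  trig : Fin n → PMF (Finset (Fin n))
  /-- Triggering sets consist of in-neighbors. -/
  trig_subset : ∀ v, ∀ T ∈ (trig v).support, ∀ u ∈ T, (u, v) ∈ E

namespace TriggeringModel

variable {n : ℕ} (M : TriggeringModel n)

/-- The in-degree of a node. -/
def inDegree (v : Fin n) : ℕ := (M.E.filter (fun e => e.2 = v)).card

/-- `Γ(L, S)`: the nodes reachable from `S` in the live-edge graph `L` given by triggering sets `T`,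
whose edges are the pairs `(u, v)` with `u ∈ T v`. -/
def reach (T : Fin n → Finset (Fin n)) (S : Finset (Fin n)) : Set (Fin n) :=
  {w | ∃ s ∈ S, Relation.ReflTransGen (fun u v => u ∈ T v) s w}

/-- The probability that independently drawn triggering sets are equal to `T`. -/
def liveProb (T : Fin n → Finset (Fin n)) : ℝ := ∏ v, (M.trig v (T v)).toReal

/-- The influence spread `σ(S) = ∑_L Pr(L) |Γ(L, S)|`. -/
def spread (S : Finset (Fin n)) : ℝ :=
  ∑ T : Fin n → Finset (Fin n), M.liveProb T * ((reach T S).ncard : ℝ)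

end TriggeringModel

/-- The Shapley value of a player `v` in the coalitional game with characteristic function `τ`.
The players preceding `v` in the order `π` are those `u` with `π u < π v`. -/
def shapleyValue {n : ℕ} (τ : Finset (Fin n) → ℝ) (v : Fin n) : ℝ :=
  (∑ π : Equiv.Perm (Fin n),
    (τ (insert v (Finset.univ.filter (fun u => π u < π v)))
      - τ (Finset.univ.filter (fun u => π u < π v)))) / (n.factorial : ℝ)

/-- The `k`-th largest of the `n` values of `f`, counted with multiplicity (`1 ≤ k ≤ n`). -/
def kthLargest {n : ℕ} (k : ℕ) (f : Fin n → ℝ) : ℝ :=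
  ((Finset.univ.val.map f).sort (fun a b => b ≤ a)).getD (k - 1) 0

namespace TriggeringModel

variable {n : ℕ} (M : TriggeringModel n)

/-- The Shapley centrality of a node: the Shapley value of the influence spread. -/
def shapley (v : Fin n) : ℝ := shapleyValue M.spread v

/-- The expected influence spread of a random single node that is drawn with probability
proportional to its in-degree (for a graph with at least one edge). -/
def inDegreeSpread : ℝ := ∑ v, (M.inDegree v : ℝ) / (M.E.card : ℝ) * M.spread {v}

/-! ### Random reverse reachable sets

Randomized procedures are `PMF`s of pairs that consist of a result and of the time spent. The time
of drawing the triggering set of `u` is `drawTime u`; every other elementary operation takes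
one unit. -/

/-- The reversed diffusion process. `R` is the current set, `D` the set of those nodes of `R` which
already have a triggering set, `t` the time spent so far. As long as `R` has a node `u` without a
triggering set, draw one for `u` (time `drawTime u`) and add it to `R` (one unit for `u` and one
for each node of the triggering set). As `D` grows in each step, `n` steps are enough. -/
def grow (drawTime : Fin n → ℝ≥0) :
    ℕ → Finset (Fin n) → Finset (Fin n) → ℝ≥0 → PMF (Finset (Fin n) × ℝ≥0)
  | 0, R, _, t => PMF.pure (R, t)
  | j + 1, R, D, t =>
    if h : (R \ D).Nonempty then
      (M.trig ((R \ D).min' h)).bind fun T =>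
        grow drawTime j (R ∪ T) (insert ((R \ D).min' h) D)
          (t + drawTime ((R \ D).min' h) + 1 + (T.card : ℝ≥0))
    else PMF.pure (R, t)

/-- A random RR set and the time of generating it: choose a uniformly random root (one unit) and run
the reversed diffusion process from the root. -/
def sampleRR [NeZero n] (drawTime : Fin n → ℝ≥0) : PMF (Finset (Fin n) × ℝ≥0) :=
  (PMF.uniformOfFintype (Fin n)).bind fun v => M.grow drawTime n {v} ∅ 1

/-! ### The algorithm ASV-RR

The estimates are stored as a table of the nodes with a nonzero estimate, so that the
estimates are reset in one unit, and finding the `k`-th largest estimate and returning the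
result take one unit plus one unit for each stored node. -/

/-- The number of stored estimates. -/
def stored (est : Fin n → ℝ) : ℕ := (Finset.univ.filter (fun v => est v ≠ 0)).card

/-- Generate `j` random RR sets one after the other, and for each of them, `R`, add `1 / |R|` to the
estimates of the nodes in `R` (one unit per node, and one unit for the loop). -/
def accumulate [NeZero n] (drawTime : Fin n → ℝ≥0) :
    ℕ → (Fin n → ℝ) → ℝ≥0 → PMF ((Fin n → ℝ) × ℝ≥0)
  | 0, est, t => PMF.pure (est, t)
  | j + 1, est, t =>
    (M.sampleRR drawTime).bind fun r =>
      accumulate drawTime j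
        (fun u => if u ∈ r.1 then est u + 1 / (r.1.card : ℝ) else est u)
        (t + r.2 + (r.1.card : ℝ≥0) + 1)

end TriggeringModel

/-- The target `x = n / 2 ^ i` of the `i`-th iteration of Phase 1. -/
def phaseOneTarget (n i : ℕ) : ℝ := (n : ℝ) / 2 ^ i

/-- The total number `θ_i` of RR sets generated up to the `i`-th iteration of Phase 1, where `δ` is
the error parameter of Phase 1; `θ_0 = 0`. -/
def phaseOneCount (n : ℕ) (δ l : ℝ) (i : ℕ) : ℕ :=
  if i = 0 then 0
  else ⌈(n : ℝ) * ((l + 1) * Real.log n + Real.log (Real.logb 2 n) + Real.log 2)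
      * (2 + 2 / 3 * δ) / (δ ^ 2 * phaseOneTarget n i)⌉₊

/-- The number `θ` of RR sets generated in Phase 2. -/
def phaseTwoCount (n : ℕ) (ε l LB : ℝ) : ℕ :=
  ⌈(n : ℝ) * ((l + 1) * Real.log n + Real.log 4) * (2 + 2 / 3 * ε) / (ε ^ 2 * LB)⌉₊

namespace TriggeringModel

variable {n : ℕ} (M : TriggeringModel n)

/-- The loop of Phase 1 from the `i`-th iteration on, with `j` iterations left. It returns the lower
bound `LB`. Each iteration takes one unit for the arithmetic and the test, besides the time of the RR
sets and of finding the `k`-th largest estimate. -/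
def phaseOne [NeZero n] (drawTime : Fin n → ℝ≥0) (δ l : ℝ) (k : ℕ) :
    ℕ → ℕ → (Fin n → ℝ) → ℝ≥0 → PMF (ℝ × ℝ≥0)
  | 0, _, _, t => PMF.pure (1, t)
  | j + 1, i, est, t =>
    (M.accumulate drawTime (phaseOneCount n δ l i - phaseOneCount n δ l (i - 1)) est t).bind
      fun s =>
        if (1 + δ) * phaseOneTarget n i
            ≤ (n : ℝ) * kthLargest k s.1 / (phaseOneCount n δ l i : ℝ) then
          PMF.pure ((n : ℝ) * kthLargest k s.1 / ((phaseOneCount n δ l i : ℝ) * (1 + δ)),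
            s.2 + (stored s.1 : ℝ≥0) + 2)
        else
          phaseOne drawTime δ l k j (i + 1) s.1 (s.2 + (stored s.1 : ℝ≥0) + 2)

/-- Algorithm ASV-RR: the joint distribution of the returned estimates and of the running time.
Phase 1 has `⌊log₂ n⌋ - 1` iterations (none if this is not positive) and the error parameter
`√2 * ε`; the estimates are set to `0` at the beginning of both phases. -/
def asvRR [NeZero n] (drawTime : Fin n → ℝ≥0) (ε l : ℝ) (k : ℕ) :
    PMF ((Fin n → ℝ) × ℝ≥0) :=
  (M.phaseOne drawTime (Real.sqrt 2 * ε) l k (Nat.log 2 n - 1) 1 (fun _ => 0) 1).bind fun b =>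
    (M.accumulate drawTime (phaseTwoCount n ε l b.1) (fun _ => 0) (b.2 + 2)).bind fun s =>
      PMF.pure (fun v => (n : ℝ) * s.1 v / (phaseTwoCount n ε l b.1 : ℝ),
        s.2 + (stored s.1 : ℝ≥0) + 1)

end TriggeringModel

end

/-! The whole analysis rests on one description of a random RR set `R`: drawing triggering sets on
demand has the same effect as drawing all of them in advance (`expect_grow`), so that `R` is the
reverse reachable set of a uniformly random root in a random live-edge graph (`expect_sampleRR`).
The spread is an average of the games "does `S` meet `R`?", and by symmetry such a game gives every
member of `R` the Shapley value `1 / |R|` (`shapleyValue_hitting`). Hence `ψ_v / n` is the mean of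
what one RR set adds to the estimate of `v`. Unbiasedness follows because the RR sets of Phase 2 are
independent of the lower bound `LB` that determines their number, and normalization because every
nonempty RR set adds `1` in total.

For robustness, the exponential moments of an estimate are those of independent summands in `[0, 1]`,
which gives Chernoff bounds in Bernstein's form (`accumulate_upper_tail`, `accumulate_lower_tail`).
If an iteration of Phase 1 returns a bound above `ψ^(k)`, then some node with centrality at most
`ψ^(k)` is overestimated; a union bound over nodes and iterations makes this unlikely
(`phaseOne_overshoot_le`). With `LB ≤ ψ^(k)`, the sample of Phase 2 is large enough
(`phaseTwo_inaccurate_le`). The union bound over iterations works with the RR sets that would have been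
generated had the loop not stopped, so that the estimates tested in iteration `i` have the law of
`θ_i` RR sets.

For the running time, the expected cost of an RR set is `O((m + n) / n)` times the expected spread of
a node drawn by in-degree (`rrCost_le`). It remains to count RR sets. Let `I` be the first iteration
whose target is smaller than `ψ^(k)` by a large constant factor. The test of iteration `I` fails with
probability at most `k / n` (`accumulate_test_fails_le`), and `k ψ^(k) ≤ n` since the centralities sum
to `n`; so the worst case, `O(n l log n / ε ^ 2)` RR sets, contributes an admissible amount. If the
loop stops by iteration `I`, then `LB` is at least the target of `I`, which is of order `ψ^(k)`, and
Phase 2 is short. The sample sizes `θ_i` double, so the work on the table of estimates in all these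
iterations is paid for by the last of them. If there is no such iteration, then `ψ^(k)` is bounded and
the worst case is good enough. -/

/-! ### Expectations of nonnegative functions under a `PMF` -/

namespace PMF

variable {α β : Type*}

/-- The expectation of a `[0, ∞]`-valued function under a `PMF`. -/
noncomputable def expect (p : PMF α) (f : α → ℝ≥0∞) : ℝ≥0∞ := ∑' a, p a * f a

theorem expect_pure (a : α) (f : α → ℝ≥0∞) : expect (pure a) f = f a := by
  rw [expect, tsum_eq_single a]
  · simp
  · intro b hb
    simp [pure_apply, hb]

theorem expect_bind (p : PMF α) (q : α → PMF β) (f : β → ℝ≥0∞) :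
    expect (p.bind q) f = expect p fun a => expect (q a) f := by
  simp only [expect, bind_apply, ← ENNReal.tsum_mul_right, ← ENNReal.tsum_mul_left]
  rw [ENNReal.tsum_comm]
  simp only [mul_assoc]

theorem expect_mono_of_support {p : PMF α} {f g : α → ℝ≥0∞} (h : ∀ a ∈ p.support, f a ≤ g a) :
    expect p f ≤ expect p g := by
  refine ENNReal.tsum_le_tsum fun a => ?_
  by_cases ha : a ∈ p.support
  · exact mul_le_mul_right (h a ha) _
  · rw [mem_support_iff, not_not] at ha
    simp [ha]

theorem expect_mono {p : PMF α} {f g : α → ℝ≥0∞} (h : ∀ a, f a ≤ g a) :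
    expect p f ≤ expect p g :=
  expect_mono_of_support fun a _ => h a

theorem expect_congr_of_support {p : PMF α} {f g : α → ℝ≥0∞} (h : ∀ a ∈ p.support, f a = g a) :
    expect p f = expect p g :=
  le_antisymm (expect_mono_of_support fun a ha => (h a ha).le)
    (expect_mono_of_support fun a ha => (h a ha).ge)

theorem expect_add (p : PMF α) (f g : α → ℝ≥0∞) :
    (expect p fun a => f a + g a) = expect p f + expect p g := by
  simp only [expect, mul_add, ENNReal.tsum_add]

theorem expect_const_mul (p : PMF α) (c : ℝ≥0∞) (f : α → ℝ≥0∞) :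
    (expect p fun a => c * f a) = c * expect p f := by
  simp only [expect, ← ENNReal.tsum_mul_left]
  exact tsum_congr fun a => by ring

theorem expect_mul_const (p : PMF α) (c : ℝ≥0∞) (f : α → ℝ≥0∞) :
    (expect p fun a => f a * c) = expect p f * c := by
  simp only [expect, ← ENNReal.tsum_mul_right, mul_assoc]

theorem expect_const (p : PMF α) (c : ℝ≥0∞) : (expect p fun _ => c) = c := by
  simp only [expect, ENNReal.tsum_mul_right, p.tsum_coe, one_mul]

theorem expect_eq_finset_sum [Fintype α] (p : PMF α) (f : α → ℝ≥0∞) :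
    expect p f = ∑ a, p a * f a :=
  tsum_fintype _

theorem toOuterMeasure_eq_expect (p : PMF α) (s : Set α) :
    p.toOuterMeasure s = expect p (s.indicator 1) := by
  rw [toOuterMeasure_apply]
  refine tsum_congr fun a => ?_
  by_cases ha : a ∈ s <;> simp [ha]

theorem toOuterMeasure_le_one (p : PMF α) (s : Set α) : p.toOuterMeasure s ≤ 1 := by
  rw [toOuterMeasure_eq_expect, ← p.expect_const 1]
  exact expect_mono fun a => Set.indicator_le_self' (fun _ _ => zero_le) a

theorem one_sub_le_toOuterMeasure {p : PMF α} {s : Set α} {b : ℝ≥0∞}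
    (h : p.toOuterMeasure sᶜ ≤ b) : 1 - b ≤ p.toOuterMeasure s := by
  rw [tsub_le_iff_right]
  calc (1 : ℝ≥0∞) = p.expect fun _ => 1 := (p.expect_const 1).symm
    _ = p.toOuterMeasure s + p.toOuterMeasure sᶜ := by
      rw [toOuterMeasure_eq_expect, toOuterMeasure_eq_expect, ← expect_add]
      congr 1
      funext a
      by_cases ha : a ∈ s <;> simp [ha]
    _ ≤ _ := by gcongr

/-- Markov's inequality in the exponential form used for Chernoff bounds. -/
theorem toOuterMeasure_le_exp_mul_expect (p : PMF α) {s : Set α} {f : α → ℝ} {b : ℝ}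
    (h : ∀ a ∈ s, b ≤ f a) :
    p.toOuterMeasure s
      ≤ ENNReal.ofReal (Real.exp (-b)) * p.expect fun a => ENNReal.ofReal (Real.exp (f a)) := by
  rw [toOuterMeasure_eq_expect, ← expect_const_mul]
  refine expect_mono fun a => ?_
  by_cases ha : a ∈ s
  · rw [← ENNReal.ofReal_mul (Real.exp_pos _).le, ← Real.exp_add]
    simpa [ha] using h a ha
  · simp [ha]

end PMF

/-! ### Order statistics -/

theorem card_filter_eq_countP_sort {n : ℕ} (f : Fin n → ℝ) (P : ℝ → Prop) [DecidablePred P] :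
    (Finset.univ.filter fun v => P (f v)).card
      = ((Finset.univ.val.map f).sort fun a b => b ≤ a).countP (fun x => decide (P x)) := by
  rw [← Multiset.coe_countP, Multiset.sort_eq, Multiset.countP_map]
  rfl

theorem length_sort_map {n : ℕ} (f : Fin n → ℝ) :
    ((Finset.univ.val.map f).sort fun a b => b ≤ a).length = n := by
  simp

/-- At least `k` values are at least as large as the `k`-th largest one. -/
theorem le_card_kthLargest_le {n k : ℕ} (hk : 1 ≤ k) (hkn : k ≤ n) (f : Fin n → ℝ) :
    k ≤ (Finset.univ.filter fun v => kthLargest k f ≤ f v).card := by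
  rw [card_filter_eq_countP_sort f (fun x => kthLargest k f ≤ x)]
  unfold kthLargest
  set L := (Finset.univ.val.map f).sort fun a b => b ≤ a with hL
  have hlen : L.length = n := length_sort_map f
  have hs : L.Pairwise (fun a b => b ≤ a) := Multiset.pairwise_sort _ _
  have hlt : k - 1 < L.length := by omega
  rw [List.getD_eq_getElem _ _ hlt]
  have hall : ∀ x ∈ L.take k, L[k - 1] ≤ x := by
    intro x hx
    obtain ⟨i, hi, rfl⟩ := List.getElem_of_mem hx
    rw [List.getElem_take]
    rw [List.length_take] at hi
    rcases Nat.lt_or_ge i (k - 1) with h | h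
    · exact List.pairwise_iff_getElem.1 hs i (k - 1) (by omega) hlt h
    · have : i = k - 1 := by omega
      subst this; rfl
  calc k = (L.take k).length := by rw [List.length_take]; omega
    _ = (L.take k).countP (fun x => decide (L[k - 1] ≤ x)) := by
      rw [eq_comm, List.countP_eq_length]
      simpa using hall
    _ ≤ _ := (List.take_sublist k L).countP_le

/-- Fewer than `k` values exceed the `k`-th largest one. -/
theorem card_kthLargest_lt_lt {n k : ℕ} (hk : 1 ≤ k) (hkn : k ≤ n) (f : Fin n → ℝ) :
    (Finset.univ.filter fun v => kthLargest k f < f v).card < k := by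
  rw [card_filter_eq_countP_sort f (fun x => kthLargest k f < x)]
  unfold kthLargest
  set L := (Finset.univ.val.map f).sort fun a b => b ≤ a with hL
  have hlen : L.length = n := length_sort_map f
  have hs : L.Pairwise (fun a b => b ≤ a) := Multiset.pairwise_sort _ _
  have hlt : k - 1 < L.length := by omega
  rw [List.getD_eq_getElem _ _ hlt]
  have hall : ∀ x ∈ L.drop (k - 1), x ≤ L[k - 1] := by
    intro x hx
    obtain ⟨i, hi, rfl⟩ := List.getElem_of_mem hx
    rw [List.getElem_drop]
    rw [List.length_drop] at hi
    rcases Nat.eq_zero_or_pos i with h | h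
    · subst h; simp
    · exact List.pairwise_iff_getElem.1 hs (k - 1) (k - 1 + i) hlt (by omega) (by omega)
  have h0 : (L.drop (k - 1)).countP (fun x => decide (L[k - 1] < x)) = 0 := by
    rw [List.countP_eq_zero]
    simpa using hall
  have h1 := (L.take (k - 1)).countP_le_length (p := fun x => decide (L[k - 1] < x))
  have h2 := List.countP_append (p := fun x => decide (L[k - 1] < x))
    (l₁ := L.take (k - 1)) (l₂ := L.drop (k - 1))
  rw [List.take_append_drop] at h2
  rw [List.length_take] at h1
  omega

/-- For any two functions, some point is among the top `k` of the first one and not above the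
`k`-th largest value of the second one. -/
theorem exists_kthLargest_le_and_le_kthLargest {n k : ℕ} (hk : 1 ≤ k) (hkn : k ≤ n)
    (f g : Fin n → ℝ) : ∃ v, kthLargest k f ≤ f v ∧ g v ≤ kthLargest k g := by
  by_contra! h
  have := Finset.card_le_card (s := Finset.univ.filter fun v => kthLargest k f ≤ f v)
    (t := Finset.univ.filter fun v => kthLargest k g < g v) fun v hv => by
      simp only [Finset.mem_filter, Finset.mem_univ, true_and] at hv ⊢
      exact h v hv
  have h1 := le_card_kthLargest_le hk hkn f
  have h2 := card_kthLargest_lt_lt hk hkn g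
  omega

theorem le_kthLargest_of_card {n k : ℕ} (hk : 1 ≤ k) (hkn : k ≤ n) {f : Fin n → ℝ} {y : ℝ}
    {s : Finset (Fin n)} (hs : k ≤ s.card) (h : ∀ v ∈ s, y ≤ f v) : y ≤ kthLargest k f := by
  by_contra! hlt
  have := Finset.card_le_card (s := s)
    (t := Finset.univ.filter fun v => kthLargest k f < f v) fun v hv => by
      simpa using hlt.trans_le (h v hv)
  have := card_kthLargest_lt_lt hk hkn f
  omega

theorem mul_kthLargest_le_sum {n k : ℕ} (hk : 1 ≤ k) (hkn : k ≤ n) {f : Fin n → ℝ}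
    (hf : ∀ v, 0 ≤ f v) : k * kthLargest k f ≤ ∑ v, f v := by
  obtain ⟨s, hs, hcard⟩ := Finset.exists_subset_card_eq (le_card_kthLargest_le hk hkn f)
  calc (k : ℝ) * kthLargest k f = ∑ _v ∈ s, kthLargest k f := by simp [hcard]
    _ ≤ ∑ v ∈ s, f v := Finset.sum_le_sum fun v hv => by simpa using hs hv
    _ ≤ ∑ v, f v := Finset.sum_le_sum_of_subset_of_nonneg (Finset.subset_univ _) fun v _ _ => hf v

/-! ### Chernoff exponents -/

/-- The inequality that turns Bennett's exponent into Bernstein's exponent. -/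
theorem sq_div_le_one_add_mul_log {x : ℝ} (hx : 0 ≤ x) :
    x ^ 2 / (2 + 2 / 3 * x) ≤ (1 + x) * Real.log (1 + x) - x := by
  -- Divided by `1 + x`, the claim compares the logarithm with a rational function.
  set f : ℝ → ℝ := fun y => Real.log (1 + y) - (6 * y + 5 * y ^ 2) / (6 + 8 * y + 2 * y ^ 2)
  have hder : ∀ y, 0 ≤ y → HasDerivAt f
      (1 / (1 + y) - ((6 + 10 * y) * (6 + 8 * y + 2 * y ^ 2) - (6 * y + 5 * y ^ 2) * (8 + 4 * y))
        / (6 + 8 * y + 2 * y ^ 2) ^ 2) y := by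
    intro y hy
    have hD : 6 + 8 * y + 2 * y ^ 2 ≠ 0 := by positivity
    have h1 : HasDerivAt (fun y : ℝ => 1 + y) 1 y := (hasDerivAt_id y).const_add 1
    have h2 : HasDerivAt (fun y : ℝ => 6 * y + 5 * y ^ 2) (6 + 10 * y) y := by
      exact (((hasDerivAt_id' y).const_mul 6).add ((hasDerivAt_pow 2 y).const_mul 5)).congr_deriv
        (by push_cast; ring)
    have h3 : HasDerivAt (fun y : ℝ => 6 + 8 * y + 2 * y ^ 2) (8 + 4 * y) y := by
      exact ((((hasDerivAt_id' y).const_mul 8).const_add 6).add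
        ((hasDerivAt_pow 2 y).const_mul 2)).congr_deriv (by push_cast; ring)
    exact (h1.log (by positivity)).sub (h2.div h3 hD)
  have hmono : MonotoneOn f (Set.Ici 0) := by
    refine monotoneOn_of_deriv_nonneg (convex_Ici 0)
      (fun y hy => (hder y hy).continuousAt.continuousWithinAt) ?_ ?_
    · intro y hy
      rw [interior_Ici] at hy
      exact (hder y (le_of_lt hy)).differentiableAt.differentiableWithinAt
    · intro y hy
      rw [interior_Ici] at hy
      have hy0 : 0 < y := hy
      rw [(hder y hy0.le).deriv, sub_nonneg, div_le_div_iff₀ (by positivity) (by positivity)]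
      nlinarith [pow_pos hy0 3, pow_pos hy0 4, pow_pos hy0 2]
  have h0 : f 0 ≤ f x := hmono (Set.mem_Ici.2 le_rfl) hx hx
  have hf0 : f 0 = 0 := by simp [f]
  have h4 : (6 * x + 5 * x ^ 2) / (6 + 8 * x + 2 * x ^ 2) ≤ Real.log (1 + x) := by
    rw [hf0] at h0
    exact sub_nonneg.1 h0
  have h5 : x ^ 2 / (2 + 2 / 3 * x)
      = (1 + x) * ((6 * x + 5 * x ^ 2) / (6 + 8 * x + 2 * x ^ 2)) - x := by
    have : 6 + 8 * x + 2 * x ^ 2 = (1 + x) * (6 + 2 * x) := by ring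
    rw [this]
    field_simp
    ring
  rw [h5]
  gcongr

theorem exp_neg_le_one_sub_add_sq {x : ℝ} (hx : 0 ≤ x) : Real.exp (-x) ≤ 1 - x + x ^ 2 / 2 := by
  rw [Real.exp_neg]
  refine inv_le_of_inv_le₀ (by nlinarith [sq_nonneg (x - 1)]) ?_
  refine le_trans ?_ (Real.quadratic_le_exp_of_nonneg hx)
  rw [inv_le_iff_one_le_mul₀ (by nlinarith [sq_nonneg (x - 1)])]
  nlinarith [sq_nonneg (x ^ 2)]

theorem exp_mul_le_one_add {x y : ℝ} (hx : 0 ≤ x) (hx1 : x ≤ 1) :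
    Real.exp (y * x) ≤ 1 + x * (Real.exp y - 1) := by
  have := convexOn_exp.2 (Set.mem_univ 0) (Set.mem_univ y) (sub_nonneg.2 hx1) hx (by ring)
  simp only [smul_eq_mul, mul_zero, zero_add, Real.exp_zero, mul_one] at this
  rw [mul_comm y x]
  linarith

/-! ### Shapley values of hitting games -/

/-- What a reverse reachable set `R` adds to the estimate of `v`: `1 / |R|` for `v ∈ R`. -/
noncomputable def share {n : ℕ} (R : Finset (Fin n)) (v : Fin n) : ℝ :=
  if v ∈ R then 1 / (R.card : ℝ) else 0

section Share

variable {n : ℕ}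

theorem share_nonneg (R : Finset (Fin n)) (v : Fin n) : 0 ≤ share R v := by
  unfold share; split_ifs <;> positivity

theorem share_le_one (R : Finset (Fin n)) (v : Fin n) : share R v ≤ 1 := by
  unfold share
  split_ifs with h
  · have : 0 < R.card := Finset.card_pos.2 ⟨v, h⟩
    rw [div_le_one (by exact_mod_cast this)]
    exact_mod_cast this
  · exact zero_le_one

theorem sum_share {R : Finset (Fin n)} (hR : R.Nonempty) : ∑ v, share R v = 1 := by
  have : (R.card : ℝ) ≠ 0 := by exact_mod_cast hR.card_pos.ne'
  simp [share, Finset.sum_ite_mem, this]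

/-- The game in which a coalition is worth `1` if it meets `R`, and `0` otherwise. -/
noncomputable def hitting (R S : Finset (Fin n)) : ℝ :=
  open Classical in if (R ∩ S).Nonempty then 1 else 0

theorem hitting_nonneg (R S : Finset (Fin n)) : 0 ≤ hitting R S := by
  unfold hitting; split_ifs <;> norm_num

theorem shapleyValue_finset_sum {ι : Type*} (s : Finset ι) (a : ι → ℝ)
    (τ : ι → Finset (Fin n) → ℝ) (v : Fin n) :
    shapleyValue (fun S => ∑ i ∈ s, a i * τ i S) v = ∑ i ∈ s, a i * shapleyValue (τ i) v := by
  simp only [shapleyValue, ← Finset.sum_sub_distrib, mul_div_assoc', Finset.mul_sum]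
  rw [Finset.sum_comm, Finset.sum_div]
  simp only [mul_sub]

theorem hitting_insert_sub (R : Finset (Fin n)) (π : Equiv.Perm (Fin n)) (v : Fin n) :
    hitting R (insert v (Finset.univ.filter fun u => π u < π v))
        - hitting R (Finset.univ.filter fun u => π u < π v)
      = if v ∈ R ∧ ∀ u ∈ R, π v ≤ π u then 1 else 0 := by
  unfold hitting
  by_cases hlt : ∃ u ∈ R, π u < π v
  · obtain ⟨u, hu, huv⟩ := hlt
    have h1 : (R ∩ insert v (Finset.univ.filter fun u => π u < π v)).Nonempty :=
      ⟨u, by simp [hu, huv]⟩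
    have h2 : (R ∩ (Finset.univ.filter fun u => π u < π v)).Nonempty := ⟨u, by simp [hu, huv]⟩
    have h3 : ¬ (v ∈ R ∧ ∀ u ∈ R, π v ≤ π u) := fun h => absurd (h.2 u hu) (not_le.2 huv)
    rw [if_pos h1, if_pos h2, if_neg h3, sub_self]
  · push Not at hlt
    have h2 : ¬ (R ∩ (Finset.univ.filter fun u => π u < π v)).Nonempty := by
      rintro ⟨u, hu⟩
      simp only [Finset.mem_inter, Finset.mem_filter, Finset.mem_univ, true_and] at hu
      exact absurd (hlt u hu.1) (not_le.2 hu.2)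
    rw [if_neg h2, sub_zero]
    congr 1
    refine propext ⟨?_, fun h => ⟨v, by simp [h.1]⟩⟩
    rintro ⟨u, hu⟩
    simp only [Finset.mem_inter, Finset.mem_insert, Finset.mem_filter, Finset.mem_univ,
      true_and] at hu
    rcases hu.2 with rfl | h
    · exact ⟨hu.1, hlt⟩
    · exact absurd (hlt u hu.1) (not_le.2 h)

/-- Each element of `R` comes first among `R` in the same number of orders. -/
theorem card_perm_first_eq {R : Finset (Fin n)} {u v : Fin n} (hu : u ∈ R) (hv : v ∈ R) :
    (Finset.univ.filter fun π : Equiv.Perm (Fin n) => ∀ w ∈ R, π u ≤ π w).card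
      = (Finset.univ.filter fun π : Equiv.Perm (Fin n) => ∀ w ∈ R, π v ≤ π w).card := by
  have hmem : ∀ w ∈ R, Equiv.swap u v w ∈ R := by
    intro w hw
    by_cases h1 : w = u
    · subst h1; simpa using hv
    · by_cases h2 : w = v
      · subst h2; simpa using hu
      · rwa [Equiv.swap_apply_of_ne_of_ne h1 h2]
  refine Finset.card_bij' (fun π _ => π * Equiv.swap u v) (fun π _ => π * Equiv.swap u v)
    ?_ ?_ ?_ ?_
  · intro π hπ
    simp only [Finset.mem_filter, Finset.mem_univ, true_and, Equiv.Perm.coe_mul,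
      Function.comp_apply, Equiv.swap_apply_right] at hπ ⊢
    exact fun w hw => hπ _ (hmem w hw)
  · intro π hπ
    simp only [Finset.mem_filter, Finset.mem_univ, true_and, Equiv.Perm.coe_mul,
      Function.comp_apply, Equiv.swap_apply_left] at hπ ⊢
    exact fun w hw => hπ _ (hmem w hw)
  · intro π _; simp [mul_assoc]
  · intro π _; simp [mul_assoc]

theorem sum_card_perm_first {R : Finset (Fin n)} (hR : R.Nonempty) :
    ∑ u ∈ R, (Finset.univ.filter fun π : Equiv.Perm (Fin n) => ∀ w ∈ R, π u ≤ π w).card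
      = n.factorial := by
  simp only [Finset.card_filter]
  rw [Finset.sum_comm]
  have h : ∀ π : Equiv.Perm (Fin n), (∑ u ∈ R, if ∀ w ∈ R, π u ≤ π w then 1 else 0) = 1 := by
    intro π
    obtain ⟨u, hu, hmin⟩ := R.exists_min_image π hR
    rw [Finset.sum_eq_single_of_mem u hu, if_pos hmin]
    intro w hw hne
    rw [if_neg]
    intro hcon
    exact hne (π.injective (le_antisymm (hcon u hu) (hmin w hw)))
  simp [h, Fintype.card_perm]

/-- By symmetry the members of `R` share the unit that the grand coalition earns. -/
theorem shapleyValue_hitting (R : Finset (Fin n)) (v : Fin n) :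
    shapleyValue (hitting R) v = share R v := by
  unfold shapleyValue share
  simp only [hitting_insert_sub]
  by_cases hv : v ∈ R
  · have h : (R.card : ℝ)
        * (Finset.univ.filter fun π : Equiv.Perm (Fin n) => ∀ w ∈ R, π v ≤ π w).card
        = n.factorial := by
      rw [← sum_card_perm_first ⟨v, hv⟩, Finset.sum_congr rfl fun u hu => card_perm_first_eq hu hv]
      simp
    have hR : (R.card : ℝ) ≠ 0 := by exact_mod_cast (Finset.card_pos.2 ⟨v, hv⟩).ne'
    have hn : (n.factorial : ℝ) ≠ 0 := by exact_mod_cast n.factorial_ne_zero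
    simp only [hv, true_and, if_true, Finset.sum_boole]
    rw [div_eq_div_iff hn hR, ← h]
    ring
  · simp [hv]

end Share

namespace TriggeringModel

variable {n : ℕ} (M : TriggeringModel n)

/-! ### Reverse reachable sets and the live-edge graph -/

/-- The nodes from which `w` is reachable in the live-edge graph given by `T`. -/
noncomputable def revReach (T : Fin n → Finset (Fin n)) (w : Fin n) : Finset (Fin n) :=
  open Classical in
  Finset.univ.filter fun u => Relation.ReflTransGen (fun a b => a ∈ T b) u w

theorem mem_revReach {T : Fin n → Finset (Fin n)} {u w : Fin n} :
    u ∈ revReach T w ↔ Relation.ReflTransGen (fun a b => a ∈ T b) u w := by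
  simp [revReach]

theorem self_mem_revReach (T : Fin n → Finset (Fin n)) (w : Fin n) : w ∈ revReach T w :=
  mem_revReach.2 .refl

theorem ncard_reach (T : Fin n → Finset (Fin n)) (S : Finset (Fin n)) :
    ((reach T S).ncard : ℝ) = ∑ w, hitting (revReach T w) S := by
  classical
  have h : reach T S = ↑(Finset.univ.filter fun w => (revReach T w ∩ S).Nonempty) := by
    ext w
    simp only [reach, Set.mem_ofPred_eq, Finset.coe_filter, Finset.mem_univ, true_and,
      Finset.Nonempty, Finset.mem_inter, mem_revReach]
    exact ⟨fun ⟨s, h1, h2⟩ => ⟨s, h2, h1⟩, fun ⟨s, h1, h2⟩ => ⟨s, h2, h1⟩⟩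
  rw [h, Set.ncard_coe_finset]
  simp [hitting]

theorem spread_eq (S : Finset (Fin n)) :
    M.spread S = ∑ T, M.liveProb T * ∑ w, hitting (revReach T w) S := by
  simp only [spread, ncard_reach]

/-- The Shapley centrality is the expected share of `v` in the reverse reachable sets of all
roots. -/
theorem shapley_eq (v : Fin n) :
    M.shapley v = ∑ T, M.liveProb T * ∑ w, share (revReach T w) v := by
  have h : M.spread = fun S => ∑ p : (Fin n → Finset (Fin n)) × Fin n,
      M.liveProb p.1 * hitting (revReach p.1 p.2) S := by
    funext S
    rw [spread_eq, Fintype.sum_prod_type]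
    simp only [Finset.mul_sum]
  rw [shapley, h, shapleyValue_finset_sum, Fintype.sum_prod_type]
  simp only [shapleyValue_hitting, Finset.mul_sum]

/-- The probability of the triggering sets `T`, as an extended nonnegative real. -/
noncomputable def liveWeight (T : Fin n → Finset (Fin n)) : ℝ≥0∞ := ∏ v, M.trig v (T v)

theorem toReal_liveWeight (T : Fin n → Finset (Fin n)) :
    (M.liveWeight T).toReal = M.liveProb T := by
  simp [liveWeight, liveProb, ENNReal.toReal_prod]

theorem liveProb_nonneg (T : Fin n → Finset (Fin n)) : 0 ≤ M.liveProb T := by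
  rw [← toReal_liveWeight]; exact ENNReal.toReal_nonneg

theorem liveWeight_eq_ofReal (T : Fin n → Finset (Fin n)) :
    M.liveWeight T = ENNReal.ofReal (M.liveProb T) := by
  rw [← toReal_liveWeight, ENNReal.ofReal_toReal]
  exact ENNReal.prod_ne_top fun v _ => (M.trig v).apply_ne_top _

theorem sum_trig (v : Fin n) : ∑ T, M.trig v T = 1 := by
  simpa using (M.trig v).tsum_coe

theorem sum_liveWeight : ∑ T, M.liveWeight T = 1 := by
  have := Finset.prod_univ_sum (fun _ : Fin n => (Finset.univ : Finset (Finset (Fin n))))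
    (fun v T => M.trig v T)
  simp only [sum_trig, Finset.prod_const_one, Fintype.piFinset_univ] at this
  exact this.symm

theorem sum_liveProb : ∑ T, M.liveProb T = 1 := by
  have h := congrArg ENNReal.toReal M.sum_liveWeight
  rw [ENNReal.toReal_sum fun T _ => by rw [liveWeight_eq_ofReal]; exact ENNReal.ofReal_ne_top] at h
  simpa only [toReal_liveWeight, ENNReal.toReal_one] using h

/-- Redrawing the triggering set of one node does not change the distribution. -/
theorem sum_liveWeight_resample (u : Fin n) (h : (Fin n → Finset (Fin n)) → ℝ≥0∞) :
    ∑ T, M.liveWeight T * h T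
      = ∑ A, M.trig u A * ∑ T, M.liveWeight T * h (Function.update T u A) := by
  -- Exchanging the old and the new set of `u` is an involution that preserves the weights.
  let φ : (Fin n → Finset (Fin n)) × Finset (Fin n) → (Fin n → Finset (Fin n)) × Finset (Fin n) :=
    fun p => (Function.update p.1 u p.2, p.1 u)
  have hφ : Function.Involutive φ := by
    rintro ⟨T, A⟩
    simp [φ]
  have hw : ∀ T A, M.liveWeight (Function.update T u A) * M.trig u (T u)
      = M.liveWeight T * M.trig u A := by
    intro T A
    unfold liveWeight
    rw [← Finset.mul_prod_erase _ _ (Finset.mem_univ u),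
      ← Finset.mul_prod_erase _ (fun v => M.trig v (T v)) (Finset.mem_univ u),
      Finset.prod_congr rfl fun v hv => by
        rw [Function.update_of_ne (Finset.ne_of_mem_erase hv)]]
    simp only [Function.update_self]
    ring
  calc ∑ T, M.liveWeight T * h T
      = ∑ p : (Fin n → Finset (Fin n)) × Finset (Fin n),
          M.liveWeight p.1 * M.trig u p.2 * h p.1 := by
        rw [Fintype.sum_prod_type]
        refine Finset.sum_congr rfl fun T _ => ?_
        dsimp only
        rw [← Finset.sum_mul, ← Finset.mul_sum, sum_trig, mul_one]
    _ = ∑ p, M.liveWeight (φ p).1 * M.trig u (φ p).2 * h (φ p).1 :=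
        (Equiv.sum_comp hφ.toPerm
          (fun p => M.liveWeight p.1 * M.trig u p.2 * h p.1)).symm
    _ = ∑ p : (Fin n → Finset (Fin n)) × Finset (Fin n),
          M.trig u p.2 * (M.liveWeight p.1 * h (Function.update p.1 u p.2)) := by
        refine Finset.sum_congr rfl fun p _ => ?_
        simp only [φ, hw]
        ring
    _ = _ := by
        rw [Fintype.sum_prod_type_right]
        simp only [Finset.mul_sum]

/-- The reversed diffusion process along triggering sets `T` that are fixed in advance. -/
def growAlong (T : Fin n → Finset (Fin n)) :
    ℕ → Finset (Fin n) → Finset (Fin n) → Finset (Fin n)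
  | 0, R, _ => R
  | j + 1, R, D =>
    if h : (R \ D).Nonempty then
      growAlong T j (R ∪ T ((R \ D).min' h)) (insert ((R \ D).min' h) D)
    else R

theorem growAlong_update (T : Fin n → Finset (Fin n)) {u : Fin n} (A : Finset (Fin n)) (j : ℕ) :
    ∀ R D : Finset (Fin n), u ∈ D →
      growAlong (Function.update T u A) j R D = growAlong T j R D := by
  induction j with
  | zero => intro R D _; rfl
  | succ j ih =>
    intro R D hu
    simp only [growAlong]
    split_ifs with h
    · have hne : (R \ D).min' h ≠ u := by
        intro heq
        have := (R \ D).min'_mem h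
        rw [heq] at this
        exact (Finset.mem_sdiff.1 this).2 hu
      rw [ih _ _ (Finset.mem_insert_of_mem hu), Function.update_of_ne hne]
    · rfl

/-- Drawing triggering sets on demand is the same as drawing all of them in advance. -/
theorem expect_grow (d : Fin n → ℝ≥0) (f : Finset (Fin n) → ℝ≥0∞) (j : ℕ) :
    ∀ (R D : Finset (Fin n)) (t : ℝ≥0),
      ((M.grow d j R D t).expect fun r => f r.1)
        = ∑ T, M.liveWeight T * f (growAlong T j R D) := by
  induction j with
  | zero =>
    intro R D t
    simp only [grow, growAlong, PMF.expect_pure, ← Finset.sum_mul, sum_liveWeight, one_mul]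
  | succ j ih =>
    intro R D t
    simp only [grow, growAlong]
    split_ifs with h
    · rw [PMF.expect_bind]
      simp only [ih]
      rw [M.sum_liveWeight_resample ((R \ D).min' h), PMF.expect_eq_finset_sum]
      simp only [Function.update_self, growAlong_update _ _ _ _ _ (Finset.mem_insert_self _ _)]
    · simp only [PMF.expect_pure, ← Finset.sum_mul, sum_liveWeight, one_mul]

theorem growAlong_subset {T : Fin n → Finset (Fin n)} {C : Finset (Fin n)}
    (hC : ∀ u ∈ C, T u ⊆ C) (j : ℕ) :
    ∀ R D : Finset (Fin n), R ⊆ C → growAlong T j R D ⊆ C := by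
  induction j with
  | zero => intro R D h; exact h
  | succ j ih =>
    intro R D hR
    simp only [growAlong]
    split_ifs with h
    · exact ih _ _ (Finset.union_subset hR
        (hC _ (hR (Finset.mem_sdiff.1 ((R \ D).min'_mem h)).1)))
    · exact hR

theorem subset_growAlong (T : Fin n → Finset (Fin n)) (j : ℕ) :
    ∀ R D : Finset (Fin n), R ⊆ growAlong T j R D := by
  induction j with
  | zero => intro R D; exact subset_rfl
  | succ j ih =>
    intro R D
    simp only [growAlong]
    split_ifs with h
    · exact Finset.subset_union_left.trans (ih _ _)
    · exact subset_rfl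

theorem growAlong_closed (T : Fin n → Finset (Fin n)) (j : ℕ) :
    ∀ R D : Finset (Fin n), (∀ u ∈ D, T u ⊆ R) → n ≤ j + D.card →
      ∀ u ∈ growAlong T j R D, T u ⊆ growAlong T j R D := by
  induction j with
  | zero =>
    intro R D hD hn u _
    have : D = Finset.univ := by
      rw [← Finset.card_eq_iff_eq_univ, Fintype.card_fin]
      exact le_antisymm (by simpa using D.card_le_univ) (by omega)
    exact hD u (this ▸ Finset.mem_univ u)
  | succ j ih =>
    intro R D hD hn
    simp only [growAlong]
    split_ifs with h
    · apply ih
      · intro u hu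
        rcases Finset.mem_insert.1 hu with rfl | hu
        · exact Finset.subset_union_right
        · exact (hD u hu).trans Finset.subset_union_left
      · have := (Finset.mem_sdiff.1 ((R \ D).min'_mem h)).2
        rw [Finset.card_insert_of_notMem this]
        omega
    · intro u hu
      refine hD u ?_
      by_contra hcon
      exact h ⟨u, Finset.mem_sdiff.2 ⟨hu, hcon⟩⟩

theorem growAlong_eq_revReach (T : Fin n → Finset (Fin n)) (w : Fin n) :
    growAlong T n {w} ∅ = revReach T w := by
  refine subset_antisymm (growAlong_subset ?_ _ _ _ ?_) ?_
  · intro u hu a ha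
    exact mem_revReach.2 (.head ha (mem_revReach.1 hu))
  · simpa using self_mem_revReach T w
  · intro u hu
    induction mem_revReach.1 hu using Relation.ReflTransGen.head_induction_on with
    | refl => exact subset_growAlong T n _ _ (Finset.mem_singleton_self w)
    | head hab hbc ih =>
      exact growAlong_closed T n {w} ∅ (by simp) (by simp) _ (ih (mem_revReach.2 hbc)) hab

theorem sum_shapley : ∑ v, M.shapley v = n := by
  simp only [shapley_eq]
  rw [Finset.sum_comm]
  simp only [← Finset.mul_sum]
  have : ∀ T : Fin n → Finset (Fin n), ∑ v, ∑ w, share (revReach T w) v = n := by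
    intro T
    rw [Finset.sum_comm]
    simp [fun w => sum_share ⟨w, self_mem_revReach T w⟩]
  simp only [this, ← Finset.sum_mul, sum_liveProb, one_mul]

theorem one_le_spread_singleton (v : Fin n) : 1 ≤ M.spread {v} := by
  rw [spread_eq, ← M.sum_liveProb]
  refine Finset.sum_le_sum fun T _ => le_mul_of_one_le_right (M.liveProb_nonneg T) ?_
  refine le_trans ?_ (Finset.single_le_sum (fun w _ => hitting_nonneg _ _) (Finset.mem_univ v))
  rw [hitting, if_pos ⟨v, by simp [self_mem_revReach]⟩]

variable [NeZero n] (d : Fin n → ℝ≥0)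

/-- The distribution of a random RR set: the reverse reachable set of a random root in a random
live-edge graph. -/
theorem expect_sampleRR {g : Finset (Fin n) → ℝ} (hg : ∀ R, 0 ≤ g R) :
    ((M.sampleRR d).expect fun r => ENNReal.ofReal (g r.1))
      = ENNReal.ofReal ((∑ T, M.liveProb T * ∑ w, g (revReach T w)) / n) := by
  have hn : (0 : ℝ) < n := by exact_mod_cast Nat.pos_of_ne_zero (NeZero.ne n)
  rw [sampleRR, PMF.expect_bind, PMF.expect_eq_finset_sum]
  simp only [M.expect_grow d (fun R => ENNReal.ofReal (g R)), PMF.uniformOfFintype_apply,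
    Fintype.card_fin, growAlong_eq_revReach, liveWeight_eq_ofReal]
  rw [← Finset.mul_sum, Finset.sum_comm, div_eq_inv_mul, ENNReal.ofReal_mul (by positivity),
    ENNReal.ofReal_inv_of_pos hn, ENNReal.ofReal_natCast,
    ENNReal.ofReal_sum_of_nonneg fun T _ =>
      mul_nonneg (M.liveProb_nonneg T) (Finset.sum_nonneg fun w _ => hg _)]
  congr 1
  refine Finset.sum_congr rfl fun T _ => ?_
  rw [ENNReal.ofReal_mul (M.liveProb_nonneg T), ENNReal.ofReal_sum_of_nonneg fun w _ => hg _,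
    Finset.mul_sum]

theorem expect_sampleRR_share (v : Fin n) :
    ((M.sampleRR d).expect fun r => ENNReal.ofReal (share r.1 v))
      = ENNReal.ofReal (M.shapley v / n) := by
  rw [M.expect_sampleRR d fun R => share_nonneg R v, shapley_eq]

theorem shapley_pos (v : Fin n) : 0 < M.shapley v := by
  rw [shapley_eq]
  have hn : (0 : ℝ) < n := by exact_mod_cast Nat.pos_of_ne_zero (NeZero.ne n)
  have h : ∀ T : Fin n → Finset (Fin n), 1 / (n : ℝ) ≤ ∑ w, share (revReach T w) v := by
    intro T
    refine le_trans ?_ (Finset.single_le_sum (fun w _ => share_nonneg _ v) (Finset.mem_univ v))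
    rw [share, if_pos (self_mem_revReach T v)]
    have h1 : 0 < (revReach T v).card := Finset.card_pos.2 ⟨v, self_mem_revReach T v⟩
    have h2 : (revReach T v).card ≤ n := by simpa using (revReach T v).card_le_univ
    gcongr
  calc (0 : ℝ) < 1 / n := by positivity
    _ = ∑ T, M.liveProb T * (1 / (n : ℝ)) := by rw [← Finset.sum_mul, sum_liveProb, one_mul]
    _ ≤ _ := Finset.sum_le_sum fun T _ => mul_le_mul_of_nonneg_left (h T) (M.liveProb_nonneg T)

end TriggeringModel

namespace TriggeringModel

variable {n : ℕ} (M : TriggeringModel n)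

/-! ### Accumulating shares of RR sets -/

theorem subset_of_mem_support_grow (d : Fin n → ℝ≥0) (j : ℕ) :
    ∀ (R D : Finset (Fin n)) (t : ℝ≥0), ∀ r ∈ (M.grow d j R D t).support, R ⊆ r.1 := by
  induction j with
  | zero =>
    intro R D t r hr
    simp only [grow, PMF.support_pure, Set.mem_singleton_iff] at hr
    subst hr; exact subset_rfl
  | succ j ih =>
    intro R D t r hr
    simp only [grow] at hr
    split_ifs at hr with h
    · obtain ⟨T, -, hT⟩ := (PMF.mem_support_bind_iff _ _ _).1 hr
      exact Finset.subset_union_left.trans (ih _ _ _ r hT)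
    · simp only [PMF.support_pure, Set.mem_singleton_iff] at hr
      subst hr; exact subset_rfl

variable [NeZero n] (d : Fin n → ℝ≥0)

theorem nonempty_of_mem_support_sampleRR {r : Finset (Fin n) × ℝ≥0}
    (hr : r ∈ (M.sampleRR d).support) : r.1.Nonempty := by
  obtain ⟨v, -, hv⟩ := (PMF.mem_support_bind_iff _ _ _).1 hr
  exact ⟨v, M.subset_of_mem_support_grow d _ _ _ _ r hv (Finset.mem_singleton_self v)⟩

theorem accumulate_succ (j : ℕ) (est : Fin n → ℝ) (t : ℝ≥0) :
    M.accumulate d (j + 1) est t = (M.sampleRR d).bind fun r =>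
      M.accumulate d j (est + share r.1) (t + r.2 + (r.1.card : ℝ≥0) + 1) := by
  have h : ∀ R : Finset (Fin n),
      (fun u => if u ∈ R then est u + 1 / (R.card : ℝ) else est u) = est + share R := by
    intro R
    funext u
    simp only [share, Pi.add_apply]
    split_ifs <;> simp
  simp only [accumulate, h]

theorem expect_accumulate_add_time (f : (Fin n → ℝ) × ℝ≥0 → ℝ≥0∞) (t : ℝ≥0) (j : ℕ) :
    ∀ (est : Fin n → ℝ) (t' : ℝ≥0),
      (M.accumulate d j est (t + t')).expect f
        = (M.accumulate d j est t').expect fun s => f (s.1, t + s.2) := by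
  induction j with
  | zero => intro est t'; simp only [accumulate, PMF.expect_pure]
  | succ j ih =>
    intro est t'
    simp only [accumulate_succ, PMF.expect_bind, ← ih, add_assoc]

theorem accumulate_add (i j : ℕ) :
    ∀ (est : Fin n → ℝ) (t : ℝ≥0),
      M.accumulate d (i + j) est t
        = (M.accumulate d i est t).bind fun s => M.accumulate d j s.1 s.2 := by
  induction i with
  | zero => intro est t; simp only [accumulate, Nat.zero_add, PMF.pure_bind]
  | succ i ih =>
    intro est t
    rw [Nat.succ_add, accumulate_succ, accumulate_succ, PMF.bind_bind]
    simp only [ih]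

theorem sum_of_mem_support_accumulate (j : ℕ) :
    ∀ (est : Fin n → ℝ) (t : ℝ≥0), ∀ s ∈ (M.accumulate d j est t).support,
      ∑ v, s.1 v = ∑ v, est v + j := by
  induction j with
  | zero =>
    intro est t s hs
    simp only [accumulate, PMF.support_pure, Set.mem_singleton_iff] at hs
    subst hs; simp
  | succ j ih =>
    intro est t s hs
    rw [accumulate_succ] at hs
    obtain ⟨r, hr, hs⟩ := (PMF.mem_support_bind_iff _ _ _).1 hs
    rw [ih _ _ s hs]
    simp only [Pi.add_apply, Finset.sum_add_distrib,
      sum_share (M.nonempty_of_mem_support_sampleRR d hr)]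
    push_cast
    ring

theorem le_of_mem_support_accumulate (j : ℕ) :
    ∀ (est : Fin n → ℝ) (t : ℝ≥0), ∀ s ∈ (M.accumulate d j est t).support, est ≤ s.1 := by
  induction j with
  | zero =>
    intro est t s hs
    simp only [accumulate, PMF.support_pure, Set.mem_singleton_iff] at hs
    subst hs; exact le_rfl
  | succ j ih =>
    intro est t s hs
    rw [accumulate_succ] at hs
    obtain ⟨r, -, hs⟩ := (PMF.mem_support_bind_iff _ _ _).1 hs
    exact le_trans (le_add_of_nonneg_right fun v => share_nonneg _ v) (ih _ _ s hs)

theorem expect_accumulate (v : Fin n) (j : ℕ) :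
    ∀ (est : Fin n → ℝ) (t : ℝ≥0), 0 ≤ est v →
      ((M.accumulate d j est t).expect fun s => ENNReal.ofReal (s.1 v))
        = ENNReal.ofReal (est v + j * (M.shapley v / n)) := by
  have hμ : 0 ≤ M.shapley v / n := div_nonneg (M.shapley_pos v).le (Nat.cast_nonneg n)
  induction j with
  | zero => intro est t _; simp only [accumulate, PMF.expect_pure]; simp
  | succ j ih =>
    intro est t hest
    rw [accumulate_succ, PMF.expect_bind]
    have h : ∀ r : Finset (Fin n) × ℝ≥0,
        ((M.accumulate d j (est + share r.1) (t + r.2 + (r.1.card : ℝ≥0) + 1)).expect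
          fun s => ENNReal.ofReal (s.1 v))
        = ENNReal.ofReal (est v + j * (M.shapley v / n)) + ENNReal.ofReal (share r.1 v) := by
      intro r
      rw [ih _ _ (add_nonneg hest (share_nonneg _ v)),
        ← ENNReal.ofReal_add (by positivity) (share_nonneg _ v)]
      congr 1
      simp only [Pi.add_apply]
      ring
    simp only [h]
    rw [PMF.expect_add, PMF.expect_const, expect_sampleRR_share,
      ← ENNReal.ofReal_add (by positivity) hμ]
    congr 1
    push_cast
    ring

/-! ### Chernoff bounds for the estimates -/

/-- Among the variables in `[0, 1]` with a given mean, the Bernoulli variable has the largest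
exponential moments. -/
theorem expect_sampleRR_exp_le (v : Fin n) (y : ℝ) :
    ((M.sampleRR d).expect fun r => ENNReal.ofReal (Real.exp (y * share r.1 v)))
      ≤ ENNReal.ofReal (Real.exp (M.shapley v / n * (Real.exp y - 1))) := by
  have hn : (n : ℝ) ≠ 0 := by exact_mod_cast NeZero.ne n
  calc _ ≤ (M.sampleRR d).expect fun r =>
          ENNReal.ofReal (1 + share r.1 v * (Real.exp y - 1)) :=
        PMF.expect_mono fun r => ENNReal.ofReal_le_ofReal
          (exp_mul_le_one_add (share_nonneg _ v) (share_le_one _ v))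
    _ = ENNReal.ofReal (1 + M.shapley v / n * (Real.exp y - 1)) := by
        rw [M.expect_sampleRR d (g := fun R => 1 + share R v * (Real.exp y - 1)) fun R =>
          (Real.exp_pos (y * share R v)).le.trans
            (exp_mul_le_one_add (share_nonneg _ v) (share_le_one _ v)), shapley_eq]
        congr 1
        simp only [Finset.sum_add_distrib, mul_add, ← Finset.sum_mul, ← mul_assoc]
        simp only [Finset.sum_const, Finset.card_univ, Fintype.card_fin, nsmul_eq_mul, mul_one,
          sum_liveProb]
        field_simp
    _ ≤ _ := ENNReal.ofReal_le_ofReal (by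
        rw [add_comm]; exact Real.add_one_le_exp _)

theorem expect_accumulate_exp_le (v : Fin n) (y : ℝ) (j : ℕ) :
    ∀ (est : Fin n → ℝ) (t : ℝ≥0),
      ((M.accumulate d j est t).expect fun s => ENNReal.ofReal (Real.exp (y * s.1 v)))
        ≤ ENNReal.ofReal (Real.exp (y * est v + j * (M.shapley v / n * (Real.exp y - 1)))) := by
  induction j with
  | zero => intro est t; simp only [accumulate, PMF.expect_pure]; simp
  | succ j ih =>
    intro est t
    rw [accumulate_succ, PMF.expect_bind]
    calc _ ≤ (M.sampleRR d).expect fun r =>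
            ENNReal.ofReal (Real.exp (y * est v + j * (M.shapley v / n * (Real.exp y - 1))))
              * ENNReal.ofReal (Real.exp (y * share r.1 v)) := by
          refine PMF.expect_mono fun r => (ih _ _).trans (le_of_eq ?_)
          rw [← ENNReal.ofReal_mul (Real.exp_pos _).le, ← Real.exp_add]
          simp only [Pi.add_apply]
          ring_nf
      _ ≤ ENNReal.ofReal (Real.exp (y * est v + j * (M.shapley v / n * (Real.exp y - 1))))
            * ENNReal.ofReal (Real.exp (M.shapley v / n * (Real.exp y - 1))) := by
          rw [PMF.expect_const_mul]
          gcongr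
          exact M.expect_sampleRR_exp_le d v y
      _ = _ := by
          rw [← ENNReal.ofReal_mul (Real.exp_pos _).le, ← Real.exp_add]
          push_cast
          ring_nf

/-- Upper tail: with `a` at least the mean share, exceeding the mean by `x * j * a`. -/
theorem accumulate_upper_tail (v : Fin n) (j : ℕ) (t : ℝ≥0) {x a : ℝ} (hx : 0 ≤ x)
    (ha : M.shapley v / n ≤ a) :
    (M.accumulate d j 0 t).toOuterMeasure
        {s | j * (M.shapley v / n) + x * (j * a) ≤ s.1 v}
      ≤ ENNReal.ofReal (Real.exp (-(x ^ 2 / (2 + 2 / 3 * x) * (j * a)))) := by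
  set μ := M.shapley v / n with hμ
  have hμ0 : 0 ≤ μ := div_nonneg (M.shapley_pos v).le (Nat.cast_nonneg n)
  set y := Real.log (1 + x) with hy
  have hy0 : 0 ≤ y := Real.log_nonneg (by linarith)
  have hexp : Real.exp y = 1 + x := Real.exp_log (by linarith)
  have hyx : y ≤ x := by
    have := Real.log_le_sub_one_of_pos (show 0 < 1 + x by linarith)
    linarith
  refine (PMF.toOuterMeasure_le_exp_mul_expect _ (f := fun s : (Fin n → ℝ) × ℝ≥0 => y * s.1 v)
    (b := y * (j * μ + x * (j * a))) fun s hs => mul_le_mul_of_nonneg_left hs hy0).trans ?_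
  refine (mul_le_mul_right (M.expect_accumulate_exp_le d v y j 0 t) _).trans ?_
  rw [← ENNReal.ofReal_mul (Real.exp_pos _).le, ← Real.exp_add]
  refine ENNReal.ofReal_le_ofReal (Real.exp_le_exp.2 ?_)
  have hlog := sq_div_le_one_add_mul_log hx
  rw [← hy] at hlog
  have hja : 0 ≤ (j : ℝ) * a := mul_nonneg (Nat.cast_nonneg j) (hμ0.trans ha)
  have h1 : (j : ℝ) * μ ≤ j * a := by gcongr
  rw [hexp, Pi.zero_apply, mul_zero, zero_add]
  nlinarith [mul_le_mul_of_nonneg_right hlog hja, mul_le_mul_of_nonneg_left h1 (sub_nonneg.2 hyx)]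

/-- Lower tail: with `a` at least the mean share, falling below the mean by `x * j * a`. -/
theorem accumulate_lower_tail (v : Fin n) (j : ℕ) (t : ℝ≥0) {x a : ℝ} (hx : 0 ≤ x)
    (ha : M.shapley v / n ≤ a) :
    (M.accumulate d j 0 t).toOuterMeasure
        {s | s.1 v ≤ j * (M.shapley v / n) - x * (j * a)}
      ≤ ENNReal.ofReal (Real.exp (-(x ^ 2 / 2 * (j * a)))) := by
  set μ := M.shapley v / n with hμ
  have hμ0 : 0 ≤ μ := div_nonneg (M.shapley_pos v).le (Nat.cast_nonneg n)
  refine (PMF.toOuterMeasure_le_exp_mul_expect _ (f := fun s : (Fin n → ℝ) × ℝ≥0 => -x * s.1 v)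
    (b := -x * (j * μ - x * (j * a))) fun s hs =>
      mul_le_mul_of_nonpos_left hs (neg_nonpos.2 hx)).trans ?_
  refine (mul_le_mul_right (M.expect_accumulate_exp_le d v (-x) j 0 t) _).trans ?_
  rw [← ENNReal.ofReal_mul (Real.exp_pos _).le, ← Real.exp_add]
  refine ENNReal.ofReal_le_ofReal (Real.exp_le_exp.2 ?_)
  have hexp := exp_neg_le_one_sub_add_sq hx
  have hjμ : 0 ≤ (j : ℝ) * μ := by positivity
  have h1 : (j : ℝ) * μ ≤ j * a := by gcongr
  rw [Pi.zero_apply, mul_zero, zero_add]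
  nlinarith [mul_le_mul_of_nonneg_left hexp hjμ, mul_le_mul_of_nonneg_left h1 (sq_nonneg x)]

end TriggeringModel

theorem PMF.hasSum_of_expect_eq {α : Type*} {p : PMF α} {f : α → ℝ} {c : ℝ} (hc : 0 ≤ c)
    (hf : ∀ a ∈ p.support, 0 ≤ f a)
    (h : (p.expect fun a => ENNReal.ofReal (f a)) = ENNReal.ofReal c) :
    HasSum (fun a => (p a).toReal * f a) c := by
  have hterm : (fun a => (p a).toReal * f a)
      = fun a => (p a * ENNReal.ofReal (f a)).toReal := by
    funext a
    by_cases ha : a ∈ p.support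
    · rw [ENNReal.toReal_mul, ENNReal.toReal_ofReal (hf a ha)]
    · rw [PMF.mem_support_iff, not_not] at ha
      simp [ha]
  have hs := ENNReal.hasSum_toReal (f := fun a => p a * ENNReal.ofReal (f a))
    (by rw [← PMF.expect, h]; exact ENNReal.ofReal_ne_top)
  rw [hterm]
  have hval : (∑' a, (p a * ENNReal.ofReal (f a)).toReal) = c := by
    rw [← ENNReal.tsum_toReal_eq fun a =>
      ENNReal.mul_ne_top (p.apply_ne_top a) ENNReal.ofReal_ne_top, ← PMF.expect, h,
      ENNReal.toReal_ofReal hc]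
  exact hval ▸ hs

/-! ### Sample sizes -/

/-- The logarithm of the inverse failure probability that a single Chernoff bound of Phase 1 has to
provide. -/
noncomputable def phaseOneExponent (n : ℕ) (l : ℝ) : ℝ :=
  (l + 1) * Real.log n + Real.log (Real.logb 2 n) + Real.log 2

/-- The logarithm of the inverse failure probability that a single Chernoff bound of Phase 2 has to
provide. -/
noncomputable def phaseTwoExponent (n : ℕ) (l : ℝ) : ℝ := (l + 1) * Real.log n + Real.log 4

theorem sqrt_two_mul_pos {ε : ℝ} (hε : 0 < ε) : 0 < Real.sqrt 2 * ε := by positivity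

theorem one_le_logb_two {n : ℕ} (hn : 2 ≤ n) : 1 ≤ Real.logb 2 n := by
  rw [Real.le_logb_iff_rpow_le (by norm_num) (by positivity), Real.rpow_one]
  exact_mod_cast hn

theorem phaseOneExponent_pos {n : ℕ} (hn : 2 ≤ n) {l : ℝ} (hl : 0 < l) :
    0 < phaseOneExponent n l := by
  have h1 : 0 ≤ Real.log n := Real.log_natCast_nonneg n
  have h2 : 0 ≤ Real.log (Real.logb 2 n) := Real.log_nonneg (one_le_logb_two hn)
  have h3 : 0 < Real.log 2 := Real.log_pos (by norm_num)
  unfold phaseOneExponent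
  positivity

theorem phaseTwoExponent_pos (n : ℕ) {l : ℝ} (hl : 0 < l) : 0 < phaseTwoExponent n l := by
  have h1 : 0 ≤ Real.log n := Real.log_natCast_nonneg n
  have h3 : 0 < Real.log 4 := Real.log_pos (by norm_num)
  unfold phaseTwoExponent
  positivity

theorem mul_exp_neg_phaseOneExponent {n : ℕ} (hn : 2 ≤ n) (l : ℝ) :
    n * Real.exp (-phaseOneExponent n l) = 1 / (2 * (n : ℝ) ^ l * Real.logb 2 n) := by
  have hn0 : (0 : ℝ) < n := by positivity
  have hlog : 0 < Real.logb 2 n := zero_lt_one.trans_le (one_le_logb_two hn)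
  have h : Real.exp (phaseOneExponent n l) = (n : ℝ) ^ l * n * Real.logb 2 n * 2 := by
    rw [phaseOneExponent, Real.exp_add, Real.exp_add, Real.exp_log hlog, Real.exp_log two_pos,
      mul_comm (l + 1), ← Real.rpow_def_of_pos hn0, Real.rpow_add_one hn0.ne']
  have hp : 0 < (n : ℝ) ^ l := Real.rpow_pos_of_pos hn0 l
  rw [Real.exp_neg, h]
  field_simp

theorem mul_exp_neg_phaseTwoExponent {n : ℕ} (hn : 1 ≤ n) (l : ℝ) :
    n * Real.exp (-phaseTwoExponent n l) = 1 / (4 * (n : ℝ) ^ l) := by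
  have hn0 : (0 : ℝ) < n := by positivity
  have h : Real.exp (phaseTwoExponent n l) = (n : ℝ) ^ l * n * 4 := by
    rw [phaseTwoExponent, Real.exp_add, Real.exp_log four_pos,
      mul_comm (l + 1), ← Real.rpow_def_of_pos hn0, Real.rpow_add_one hn0.ne']
  have hp : 0 < (n : ℝ) ^ l := Real.rpow_pos_of_pos hn0 l
  rw [Real.exp_neg, h]
  field_simp

theorem phaseOneTarget_pos {n : ℕ} (hn : 1 ≤ n) (i : ℕ) : 0 < phaseOneTarget n i := by
  unfold phaseOneTarget; positivity

theorem phaseOneCount_of_pos {n : ℕ} {δ l : ℝ} {i : ℕ} (hi : 1 ≤ i) :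
    phaseOneCount n δ l i
      = ⌈(n : ℝ) * phaseOneExponent n l * (2 + 2 / 3 * δ) / (δ ^ 2 * phaseOneTarget n i)⌉₊ := by
  rw [phaseOneCount, if_neg (by omega), phaseOneExponent]

theorem phaseOneCount_pos {n : ℕ} (hn : 2 ≤ n) {δ l : ℝ} (hδ : 0 < δ) (hl : 0 < l) {i : ℕ}
    (hi : 1 ≤ i) : 0 < phaseOneCount n δ l i := by
  have := phaseOneExponent_pos hn hl
  have := phaseOneTarget_pos (show 1 ≤ n by omega) i
  rw [phaseOneCount_of_pos hi, Nat.ceil_pos]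
  positivity

theorem phaseOneCount_le_succ {n : ℕ} (hn : 2 ≤ n) {δ l : ℝ} (hδ : 0 < δ) (hl : 0 < l) {i : ℕ}
    (hi : 1 ≤ i) : phaseOneCount n δ l (i - 1) ≤ phaseOneCount n δ l i := by
  rcases hi.eq_or_lt with rfl | hi'
  · simp [phaseOneCount]
  · have h1 := phaseOneExponent_pos hn hl
    have h2 := phaseOneTarget_pos (show 1 ≤ n by omega) i
    rw [phaseOneCount_of_pos hi, phaseOneCount_of_pos (show 1 ≤ i - 1 by omega)]
    refine Nat.ceil_mono ?_
    have h3 : phaseOneTarget n i ≤ phaseOneTarget n (i - 1) := by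
      unfold phaseOneTarget
      gcongr
      · norm_num
      · omega
    gcongr

/-- The sample size of Phase 1 makes the Chernoff exponent for the mean share `x_i / n` large
enough. -/
theorem phaseOneExponent_le {n : ℕ} (hn : 2 ≤ n) {δ l : ℝ} (hδ : 0 < δ) {i : ℕ} (hi : 1 ≤ i) :
    phaseOneExponent n l ≤
      δ ^ 2 / (2 + 2 / 3 * δ) * (phaseOneCount n δ l i * (phaseOneTarget n i / n)) := by
  have hn0 : (0 : ℝ) < n := by positivity
  have h2 := phaseOneTarget_pos (show 1 ≤ n by omega) i
  have h := Nat.le_ceil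
    ((n : ℝ) * phaseOneExponent n l * (2 + 2 / 3 * δ) / (δ ^ 2 * phaseOneTarget n i))
  rw [← phaseOneCount_of_pos hi] at h
  calc phaseOneExponent n l
      = δ ^ 2 / (2 + 2 / 3 * δ) * ((n : ℝ) * phaseOneExponent n l * (2 + 2 / 3 * δ)
          / (δ ^ 2 * phaseOneTarget n i) * (phaseOneTarget n i / n)) := by field_simp
    _ ≤ _ := by gcongr

theorem phaseTwoCount_eq (n : ℕ) (ε l LB : ℝ) :
    phaseTwoCount n ε l LB
      = ⌈(n : ℝ) * phaseTwoExponent n l * (2 + 2 / 3 * ε) / (ε ^ 2 * LB)⌉₊ := by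
  rw [phaseTwoCount, phaseTwoExponent]

theorem phaseTwoCount_pos {n : ℕ} (hn : 1 ≤ n) {ε l LB : ℝ} (hε : 0 < ε) (hl : 0 < l)
    (hLB : 0 < LB) : 0 < phaseTwoCount n ε l LB := by
  have := phaseTwoExponent_pos n hl
  rw [phaseTwoCount_eq, Nat.ceil_pos]
  positivity

theorem phaseTwoExponent_le {n : ℕ} (hn : 1 ≤ n) {ε l LB : ℝ} (hε : 0 < ε) (hLB : 0 < LB) :
    phaseTwoExponent n l ≤
      ε ^ 2 / (2 + 2 / 3 * ε) * (phaseTwoCount n ε l LB * (LB / n)) := by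
  have hn0 : (0 : ℝ) < n := by positivity
  have h := Nat.le_ceil ((n : ℝ) * phaseTwoExponent n l * (2 + 2 / 3 * ε) / (ε ^ 2 * LB))
  rw [← phaseTwoCount_eq] at h
  calc phaseTwoExponent n l
      = ε ^ 2 / (2 + 2 / 3 * ε) * ((n : ℝ) * phaseTwoExponent n l * (2 + 2 / 3 * ε)
          / (ε ^ 2 * LB) * (LB / n)) := by field_simp
    _ ≤ _ := by gcongr

namespace TriggeringModel

variable {n : ℕ} (M : TriggeringModel n) [NeZero n] (d : Fin n → ℝ≥0)

/-! ### The loop of Phase 1 -/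

theorem expect_phaseOne_succ (δ l : ℝ) (k j i : ℕ) (est : Fin n → ℝ) (t : ℝ≥0)
    (f : ℝ × ℝ≥0 → ℝ≥0∞) :
    (M.phaseOne d δ l k (j + 1) i est t).expect f
      = (M.accumulate d (phaseOneCount n δ l i - phaseOneCount n δ l (i - 1)) est t).expect
        fun s =>
          if (1 + δ) * phaseOneTarget n i
              ≤ (n : ℝ) * kthLargest k s.1 / (phaseOneCount n δ l i : ℝ) then
            f ((n : ℝ) * kthLargest k s.1 / ((phaseOneCount n δ l i : ℝ) * (1 + δ)),
              s.2 + (stored s.1 : ℝ≥0) + 2)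
          else
            (M.phaseOne d δ l k j (i + 1) s.1 (s.2 + (stored s.1 : ℝ≥0) + 2)).expect f := by
  rw [phaseOne, PMF.expect_bind]
  congr 1
  funext s
  split_ifs
  · rw [PMF.expect_pure]
  · rfl

theorem expect_phaseOne_add_time (δ l : ℝ) (k : ℕ) (f : ℝ × ℝ≥0 → ℝ≥0∞) (t : ℝ≥0) (j : ℕ) :
    ∀ (i : ℕ) (est : Fin n → ℝ) (t' : ℝ≥0),
      (M.phaseOne d δ l k j i est (t + t')).expect f
        = (M.phaseOne d δ l k j i est t').expect fun b => f (b.1, t + b.2) := by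
  induction j with
  | zero => intro i est t'; simp only [phaseOne, PMF.expect_pure]
  | succ j ih =>
    intro i est t'
    simp only [expect_phaseOne_succ, expect_accumulate_add_time, ← ih, add_assoc]

/-- The law of the lower bound does not depend on the time spent so far. -/
theorem expect_phaseOne_fst (δ l : ℝ) (k : ℕ) (f : ℝ → ℝ≥0∞) (j i : ℕ) (est : Fin n → ℝ)
    (t : ℝ≥0) :
    ((M.phaseOne d δ l k j i est t).expect fun b => f b.1)
      = (M.phaseOne d δ l k j i est 0).expect fun b => f b.1 := by
  simpa using M.expect_phaseOne_add_time d δ l k (fun b => f b.1) t j i est 0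

theorem expect_accumulate_fst (f : (Fin n → ℝ) → ℝ≥0∞) (j : ℕ) (est : Fin n → ℝ)
    (t : ℝ≥0) :
    ((M.accumulate d j est t).expect fun s => f s.1)
      = (M.accumulate d j est 0).expect fun s => f s.1 := by
  simpa using M.expect_accumulate_add_time d (fun s => f s.1) t j est 0

/-- Generating the new RR sets of an iteration on top of the old ones amounts to generating the
total number. -/
theorem expect_accumulate_phaseOneCount (hn : 2 ≤ n) {δ l : ℝ} (hδ : 0 < δ) (hl : 0 < l) {i : ℕ}
    (hi : 1 ≤ i) (f : (Fin n → ℝ) → ℝ≥0∞) :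
    ((M.accumulate d (phaseOneCount n δ l (i - 1)) 0 0).expect fun s =>
        (M.accumulate d (phaseOneCount n δ l i - phaseOneCount n δ l (i - 1)) s.1 0).expect
          fun s' => f s'.1)
      = (M.accumulate d (phaseOneCount n δ l i) 0 0).expect fun s => f s.1 := by
  have h := Nat.add_sub_cancel' (phaseOneCount_le_succ (δ := δ) (l := l) hn hδ hl hi)
  conv_rhs => rw [← h, accumulate_add, PMF.expect_bind]
  simp only [M.expect_accumulate_fst d f _ _ (Prod.snd _)]

theorem le_phaseOne_bound {δ x y : ℝ} {θ : ℕ} (hδ : 0 < δ) (h : (1 + δ) * x ≤ y / (θ : ℝ)) :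
    x ≤ y / ((θ : ℝ) * (1 + δ)) := by
  rw [← div_div, le_div_iff₀ (by linarith)]
  linarith

theorem one_le_of_mem_support_phaseOne {δ : ℝ} (hδ : 0 < δ) (l : ℝ) (k j : ℕ) :
    ∀ (i : ℕ) (est : Fin n → ℝ) (t : ℝ≥0), 1 ≤ i → 2 ^ (i + j - 1) ≤ n →
      ∀ b ∈ (M.phaseOne d δ l k j i est t).support, 1 ≤ b.1 := by
  induction j with
  | zero =>
    intro i est t _ _ b hb
    simp only [phaseOne, PMF.support_pure, Set.mem_singleton_iff] at hb
    subst hb; exact le_rfl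
  | succ j ih =>
    intro i est t hi hn b hb
    rw [phaseOne] at hb
    obtain ⟨s, -, hs⟩ := (PMF.mem_support_bind_iff _ _ _).1 hb
    split_ifs at hs with h
    · simp only [PMF.support_pure, Set.mem_singleton_iff] at hs
      subst hs
      refine le_trans ?_ (le_phaseOne_bound hδ h)
      rw [phaseOneTarget, one_le_div (by positivity)]
      have : 2 ^ i ≤ n := (Nat.pow_le_pow_right two_pos (by omega)).trans hn
      exact_mod_cast this
    · exact ih (i + 1) _ _ (by omega) (by rwa [show i + 1 + j - 1 = i + (j + 1) - 1 by omega]) b hs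

theorem two_pow_log_sub_one_le : 2 ^ (1 + (Nat.log 2 n - 1) - 1) ≤ n := by
  have hn := Nat.pos_of_ne_zero (NeZero.ne n)
  exact (Nat.pow_le_pow_right two_pos (by omega)).trans (Nat.pow_log_le_self 2 hn.ne')

/-! ### Unbiasedness and absolute normalization -/

theorem expect_asvRR (ε l : ℝ) (k : ℕ) (f : (Fin n → ℝ) × ℝ≥0 → ℝ≥0∞) :
    (M.asvRR d ε l k).expect f
      = (M.phaseOne d (Real.sqrt 2 * ε) l k (Nat.log 2 n - 1) 1 0 1).expect fun b =>
          (M.accumulate d (phaseTwoCount n ε l b.1) 0 (b.2 + 2)).expect fun s =>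
            f (fun v => (n : ℝ) * s.1 v / (phaseTwoCount n ε l b.1 : ℝ),
              s.2 + (stored s.1 : ℝ≥0) + 1) := by
  simp only [asvRR, PMF.expect_bind, PMF.expect_pure]
  rfl

theorem exists_of_mem_support_asvRR {ε l : ℝ} (hε : 0 < ε) (hl : 0 < l) (k : ℕ)
    {r : (Fin n → ℝ) × ℝ≥0}
    (hr : r ∈ (M.asvRR d ε l k).support) :
    ∃ (θ : ℕ) (t : ℝ≥0), 0 < θ ∧ ∃ s ∈ (M.accumulate d θ 0 t).support,
      ∀ v, r.1 v = n * s.1 v / θ := by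
  rw [asvRR] at hr
  obtain ⟨b, hb, hr⟩ := (PMF.mem_support_bind_iff _ _ _).1 hr
  obtain ⟨s, hs, hr⟩ := (PMF.mem_support_bind_iff _ _ _).1 hr
  simp only [PMF.support_pure, Set.mem_singleton_iff] at hr
  subst hr
  have h1 := M.one_le_of_mem_support_phaseOne d (sqrt_two_mul_pos hε) l k _ 1 _ _ le_rfl
    two_pow_log_sub_one_le b hb
  exact ⟨_, _, phaseTwoCount_pos (Nat.pos_of_ne_zero (NeZero.ne n)) hε hl (by linarith), s, hs,
    fun _ => rfl⟩

theorem sum_eq_of_mem_support_asvRR {ε l : ℝ} (hε : 0 < ε) (hl : 0 < l) (k : ℕ)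
    {r : (Fin n → ℝ) × ℝ≥0}
    (hr : r ∈ (M.asvRR d ε l k).support) : ∑ v, r.1 v = n := by
  obtain ⟨θ, t, hθ, s, hs, h⟩ := M.exists_of_mem_support_asvRR d hε hl k hr
  have hθ' : (θ : ℝ) ≠ 0 := by exact_mod_cast hθ.ne'
  simp only [h]
  rw [← Finset.sum_div, ← Finset.mul_sum, M.sum_of_mem_support_accumulate d θ 0 t s hs]
  simp [hθ']

theorem hasSum_asvRR {ε l : ℝ} (hε : 0 < ε) (hl : 0 < l) (k : ℕ) (v : Fin n) :
    HasSum (fun r => (M.asvRR d ε l k r).toReal * r.1 v) (M.shapley v) := by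
  have hn := Nat.pos_of_ne_zero (NeZero.ne n)
  refine PMF.hasSum_of_expect_eq (M.shapley_pos v).le ?_ ?_
  · intro r hr
    obtain ⟨θ, t, hθ, s, hs, h⟩ := M.exists_of_mem_support_asvRR d hε hl k hr
    have := M.le_of_mem_support_accumulate d θ 0 t s hs v
    rw [h]
    simp only [Pi.zero_apply] at this
    positivity
  · rw [M.expect_asvRR d ε l k (fun r => ENNReal.ofReal (r.1 v))]
    rw [← (M.phaseOne d (Real.sqrt 2 * ε) l k (Nat.log 2 n - 1) 1 0 1).expect_const
      (ENNReal.ofReal (M.shapley v))]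
    refine PMF.expect_congr_of_support fun b hb => ?_
    have h1 := M.one_le_of_mem_support_phaseOne d (sqrt_two_mul_pos hε) l k _ 1 _ _ le_rfl
      two_pow_log_sub_one_le b hb
    have hθ : (0 : ℝ) < phaseTwoCount n ε l b.1 := by
      exact_mod_cast phaseTwoCount_pos hn hε hl (by linarith)
    have hn0 : (0 : ℝ) < n := by exact_mod_cast hn
    have h2 : ∀ s : (Fin n → ℝ) × ℝ≥0,
        ENNReal.ofReal ((n : ℝ) * s.1 v / (phaseTwoCount n ε l b.1 : ℝ))
          = ENNReal.ofReal (n / (phaseTwoCount n ε l b.1 : ℝ)) * ENNReal.ofReal (s.1 v) := by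
      intro s
      rw [← ENNReal.ofReal_mul (by positivity)]
      congr 1
      ring
    simp only [h2]
    rw [PMF.expect_const_mul, M.expect_accumulate d v _ 0 _ le_rfl,
      ← ENNReal.ofReal_mul (by positivity)]
    congr 1
    simp only [Pi.zero_apply, zero_add]
    field_simp


/-! ### Robustness -/

/-- With `j` RR sets and `a` at least the mean share of `v`, the estimate of `v` is off by more
than `x * a` with small probability. -/
theorem accumulate_two_sided_tail (v : Fin n) (j : ℕ) (t : ℝ≥0) {x a : ℝ} (hx : 0 ≤ x)
    (ha : M.shapley v / n ≤ a) :
    (M.accumulate d j 0 t).toOuterMeasure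
        {s | x * (j * a) < |s.1 v - j * (M.shapley v / n)|}
      ≤ ENNReal.ofReal (2 * Real.exp (-(x ^ 2 / (2 + 2 / 3 * x) * (j * a)))) := by
  have hμ0 : 0 ≤ M.shapley v / n := div_nonneg (M.shapley_pos v).le (Nat.cast_nonneg n)
  have hja : 0 ≤ (j : ℝ) * a := mul_nonneg (Nat.cast_nonneg j) (hμ0.trans ha)
  rw [two_mul, ENNReal.ofReal_add (Real.exp_pos _).le (Real.exp_pos _).le]
  refine le_trans (MeasureTheory.measure_mono (t := _ ∪ _) fun s hs => ?_)
    ((MeasureTheory.measure_union_le _ _).trans (add_le_add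
      (M.accumulate_upper_tail d v j t hx ha)
      ((M.accumulate_lower_tail d v j t hx ha).trans
        (ENNReal.ofReal_le_ofReal (Real.exp_le_exp.2 (neg_le_neg ?_))))))
  · have hs' : x * (j * a) < |s.1 v - j * (M.shapley v / n)| := hs
    rcases lt_abs.1 hs' with h | h
    · left
      show j * (M.shapley v / n) + x * (j * a) ≤ s.1 v
      linarith
    · right
      show s.1 v ≤ j * (M.shapley v / n) - x * (j * a)
      linarith
  · gcongr
    linarith

/-- Stopping the loop in iteration `i` with a bound above `ψ^(k)` is unlikely: some node whose
centrality is at most `ψ^(k)` would be overestimated. -/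
theorem accumulate_phaseOne_overshoot (hn : 2 ≤ n) {δ l : ℝ} (hδ : 0 < δ) (hl : 0 < l) {k : ℕ}
    (hk : 1 ≤ k) (hkn : k ≤ n) {i : ℕ} (hi : 1 ≤ i) :
    (M.accumulate d (phaseOneCount n δ l i) 0 0).toOuterMeasure
        {s | (1 + δ) * phaseOneTarget n i
              ≤ (n : ℝ) * kthLargest k s.1 / (phaseOneCount n δ l i : ℝ) ∧
            kthLargest k M.shapley
              < (n : ℝ) * kthLargest k s.1 / ((phaseOneCount n δ l i : ℝ) * (1 + δ))}
      ≤ ENNReal.ofReal (1 / (2 * (n : ℝ) ^ l * Real.logb 2 n)) := by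
  have hn0 : (0 : ℝ) < n := by positivity
  set θ := phaseOneCount n δ l i with hθ
  have hθ0 : (0 : ℝ) < θ := by exact_mod_cast phaseOneCount_pos hn hδ hl hi
  have hx0 := phaseOneTarget_pos (show 1 ≤ n by omega) i
  set x := phaseOneTarget n i with hx
  set a := max (kthLargest k M.shapley) x / n with ha
  have hxa : x / n ≤ a := by rw [ha]; gcongr; exact le_max_right _ _
  have hexp : phaseOneExponent n l ≤ δ ^ 2 / (2 + 2 / 3 * δ) * (θ * a) :=
    (phaseOneExponent_le hn hδ hi).trans (by gcongr)
  let B : Fin n → Set ((Fin n → ℝ) × ℝ≥0) := fun v =>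
    {s | M.shapley v ≤ kthLargest k M.shapley ∧
      θ * (M.shapley v / n) + δ * (θ * a) ≤ s.1 v}
  have hB : ∀ v, (M.accumulate d θ 0 0).toOuterMeasure (B v)
      ≤ ENNReal.ofReal (Real.exp (-phaseOneExponent n l)) := by
    intro v
    by_cases hv : M.shapley v ≤ kthLargest k M.shapley
    · have hva : M.shapley v / n ≤ a := by
        rw [ha]; gcongr; exact hv.trans (le_max_left _ _)
      refine (MeasureTheory.measure_mono fun s hs => hs.2).trans
        ((M.accumulate_upper_tail d v θ 0 hδ.le hva).trans ?_)
      exact ENNReal.ofReal_le_ofReal (Real.exp_le_exp.2 (neg_le_neg hexp))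
    · have : B v = ∅ := Set.eq_empty_of_forall_notMem fun s hs => hv hs.1
      rw [this]
      simp
  calc _ ≤ (M.accumulate d θ 0 0).toOuterMeasure (⋃ v, B v) := by
        refine MeasureTheory.measure_mono fun s hs => ?_
        obtain ⟨hs1, hs2⟩ : (1 + δ) * x ≤ (n : ℝ) * kthLargest k s.1 / (θ : ℝ) ∧
          kthLargest k M.shapley < (n : ℝ) * kthLargest k s.1 / ((θ : ℝ) * (1 + δ)) := hs
        obtain ⟨v, hv1, hv2⟩ := exists_kthLargest_le_and_le_kthLargest hk hkn s.1 M.shapley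
        refine Set.mem_iUnion.2 ⟨v, hv2, ?_⟩
        have hmax : max (kthLargest k M.shapley) x
            ≤ (n : ℝ) * kthLargest k s.1 / ((θ : ℝ) * (1 + δ)) :=
          max_le hs2.le (le_phaseOne_bound hδ hs1)
        rw [le_div_iff₀ (by positivity)] at hmax
        have h1 : (1 + δ) * (θ * a) ≤ kthLargest k s.1 := by
          rw [ha]
          have : (1 + δ) * (θ * (max (kthLargest k M.shapley) x / n))
            = max (kthLargest k M.shapley) x * (θ * (1 + δ)) / n := by ring
          rw [this, div_le_iff₀ hn0]
          linarith
        have h2 : θ * (M.shapley v / n) ≤ θ * a := by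
          rw [ha]; gcongr; exact hv2.trans (le_max_left _ _)
        linarith
    _ ≤ ∑ v, (M.accumulate d θ 0 0).toOuterMeasure (B v) :=
        MeasureTheory.measure_iUnion_fintype_le _ _
    _ ≤ ∑ _v : Fin n, ENNReal.ofReal (Real.exp (-phaseOneExponent n l)) :=
        Finset.sum_le_sum fun v _ => hB v
    _ = ENNReal.ofReal (n * Real.exp (-phaseOneExponent n l)) := by
        rw [ENNReal.ofReal_mul hn0.le]
        simp
    _ = _ := by rw [mul_exp_neg_phaseOneExponent hn]

/-- The loop, entered in iteration `i` with the RR sets of the previous iterations, is unlikely to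
return a bound above `ψ^(k) ≥ 1`. -/
theorem phaseOne_overshoot (hn : 2 ≤ n) {δ l : ℝ} (hδ : 0 < δ) (hl : 0 < l) {k : ℕ}
    (hk : 1 ≤ k) (hkn : k ≤ n) (hψ : 1 ≤ kthLargest k M.shapley) (j : ℕ) :
    ∀ i : ℕ, 1 ≤ i →
      ((M.accumulate d (phaseOneCount n δ l (i - 1)) 0 0).expect fun s =>
          (M.phaseOne d δ l k j i s.1 0).expect fun b =>
            Set.indicator {y : ℝ | kthLargest k M.shapley < y} 1 b.1)
        ≤ j * ENNReal.ofReal (1 / (2 * (n : ℝ) ^ l * Real.logb 2 n)) := by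
  induction j with
  | zero =>
    intro i _
    have h : ((1 : ℝ), (0 : ℝ≥0)).1 ∉ {y : ℝ | kthLargest k M.shapley < y} := not_lt.2 hψ
    simp only [phaseOne, PMF.expect_pure, Set.indicator_of_notMem h, PMF.expect_const]
    simp
  | succ j ih =>
    intro i hi
    set g : (Fin n → ℝ) → ℝ≥0∞ := fun est =>
      (M.phaseOne d δ l k j (i + 1) est 0).expect fun b =>
        Set.indicator {y : ℝ | kthLargest k M.shapley < y} 1 b.1 with hg
    set θ := phaseOneCount n δ l i with hθ
    set A : Set ((Fin n → ℝ) × ℝ≥0) :=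
      {s | (1 + δ) * phaseOneTarget n i ≤ (n : ℝ) * kthLargest k s.1 / (θ : ℝ) ∧
        kthLargest k M.shapley < (n : ℝ) * kthLargest k s.1 / ((θ : ℝ) * (1 + δ))} with hA
    calc _ = (M.accumulate d θ 0 0).expect fun s =>
            if (1 + δ) * phaseOneTarget n i ≤ (n : ℝ) * kthLargest k s.1 / (θ : ℝ) then
              Set.indicator {y : ℝ | kthLargest k M.shapley < y} 1
                ((n : ℝ) * kthLargest k s.1 / ((θ : ℝ) * (1 + δ)))
            else g s.1 := by
          rw [← M.expect_accumulate_phaseOneCount d hn hδ hl hi fun est =>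
            if (1 + δ) * phaseOneTarget n i ≤ (n : ℝ) * kthLargest k est / (θ : ℝ) then
              Set.indicator {y : ℝ | kthLargest k M.shapley < y} 1
                ((n : ℝ) * kthLargest k est / ((θ : ℝ) * (1 + δ)))
            else g est]
          simp only [expect_phaseOne_succ, hg, ← hθ]
          simp only [M.expect_phaseOne_fst d δ l k
            (Set.indicator {y : ℝ | kthLargest k M.shapley < y} 1) j (i + 1) _
            (_ + 2)]
      _ ≤ (M.accumulate d θ 0 0).expect fun s => A.indicator 1 s + g s.1 := by
          refine PMF.expect_mono fun s => ?_
          split_ifs with h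
          · refine le_add_right ?_
            by_cases h2 : kthLargest k M.shapley
                < (n : ℝ) * kthLargest k s.1 / ((θ : ℝ) * (1 + δ))
            · have : s ∈ A := ⟨h, h2⟩
              simp [this, h2]
            · simp [h2]
          · exact le_add_left le_rfl
      _ ≤ ENNReal.ofReal (1 / (2 * (n : ℝ) ^ l * Real.logb 2 n))
            + j * ENNReal.ofReal (1 / (2 * (n : ℝ) ^ l * Real.logb 2 n)) := by
          rw [PMF.expect_add, ← PMF.toOuterMeasure_eq_expect]
          exact add_le_add (M.accumulate_phaseOne_overshoot d hn hδ hl hk hkn hi)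
            (ih (i + 1) (by omega))
      _ = _ := by push_cast; ring

theorem phaseOne_overshoot_le {δ l : ℝ} (hδ : 0 < δ) (hl : 0 < l) {k : ℕ}
    (hk : 1 ≤ k) (hkn : k ≤ n) (hψ : 1 ≤ kthLargest k M.shapley) (t : ℝ≥0) :
    ((M.phaseOne d δ l k (Nat.log 2 n - 1) 1 0 t).expect fun b =>
        Set.indicator {y : ℝ | kthLargest k M.shapley < y} 1 b.1)
      ≤ ENNReal.ofReal (1 / (2 * (n : ℝ) ^ l)) := by
  have hn := Nat.pos_of_ne_zero (NeZero.ne n)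
  rw [M.expect_phaseOne_fst d δ l k (Set.indicator {y : ℝ | kthLargest k M.shapley < y} 1)]
  rcases Nat.lt_or_ge n 2 with h1 | h2
  · have : Nat.log 2 n - 1 = 0 := by rw [Nat.log_of_lt h1]
    have h : ((1 : ℝ), (0 : ℝ≥0)).1 ∉ {y : ℝ | kthLargest k M.shapley < y} := not_lt.2 hψ
    simp only [this, phaseOne, PMF.expect_pure, Set.indicator_of_notMem h]
    exact zero_le
  · have h := M.phaseOne_overshoot d h2 hδ hl hk hkn hψ (Nat.log 2 n - 1) 1 le_rfl
    simp only [Nat.sub_self, phaseOneCount, if_true, accumulate, PMF.expect_pure] at h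
    refine h.trans ?_
    rw [← ENNReal.ofReal_natCast, ← ENNReal.ofReal_mul (Nat.cast_nonneg _)]
    refine ENNReal.ofReal_le_ofReal ?_
    have hlog : 0 < Real.logb 2 n := zero_lt_one.trans_le (one_le_logb_two h2)
    have hp : 0 < (n : ℝ) ^ l := Real.rpow_pos_of_pos (by positivity) l
    have h3 : ((Nat.log 2 n - 1 : ℕ) : ℝ) ≤ Real.logb 2 n :=
      le_trans (by exact_mod_cast Nat.sub_le _ _) (Real.natLog_le_logb n 2)
    calc ((Nat.log 2 n - 1 : ℕ) : ℝ) * (1 / (2 * (n : ℝ) ^ l * Real.logb 2 n))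
        ≤ Real.logb 2 n * (1 / (2 * (n : ℝ) ^ l * Real.logb 2 n)) := by gcongr
      _ = _ := by field_simp

/-- Phase 2 with a valid lower bound gives accurate estimates with high probability. -/
theorem phaseTwo_inaccurate_le {ε l : ℝ} (hε : 0 < ε) (hl : 0 < l) {LB ψ : ℝ} (hLB : 0 < LB)
    (hLBψ : LB ≤ ψ) (t : ℝ≥0) :
    (M.accumulate d (phaseTwoCount n ε l LB) 0 t).toOuterMeasure
        {s | ∃ v, ε * max (M.shapley v) ψ
          < |n * s.1 v / (phaseTwoCount n ε l LB : ℝ) - M.shapley v|}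
      ≤ ENNReal.ofReal (1 / (2 * (n : ℝ) ^ l)) := by
  have hn := Nat.pos_of_ne_zero (NeZero.ne n)
  have hn0 : (0 : ℝ) < n := by positivity
  have hθ0 : (0 : ℝ) < phaseTwoCount n ε l LB := by
    exact_mod_cast phaseTwoCount_pos hn hε hl hLB
  have hexp : ∀ v, phaseTwoExponent n l ≤ ε ^ 2 / (2 + 2 / 3 * ε)
      * (phaseTwoCount n ε l LB * (max (M.shapley v) ψ / n)) := fun v =>
    (phaseTwoExponent_le hn hε hLB).trans (by
      gcongr
      exact hLBψ.trans (le_max_right _ _))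
  set θ := phaseTwoCount n ε l LB with hθ
  let B : Fin n → Set ((Fin n → ℝ) × ℝ≥0) := fun v =>
    {s | ε * (θ * (max (M.shapley v) ψ / n)) < |s.1 v - θ * (M.shapley v / n)|}
  have hB : ∀ v, (M.accumulate d θ 0 t).toOuterMeasure (B v)
      ≤ ENNReal.ofReal (2 * Real.exp (-phaseTwoExponent n l)) := fun v =>
    (M.accumulate_two_sided_tail d v θ t hε.le (a := max (M.shapley v) ψ / n)
      (by gcongr; exact le_max_left _ _)).trans
      (ENNReal.ofReal_le_ofReal (by gcongr; exact hexp v))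
  calc _ ≤ (M.accumulate d θ 0 t).toOuterMeasure (⋃ v, B v) := by
        refine MeasureTheory.measure_mono fun s hs => ?_
        obtain ⟨v, hv⟩ : ∃ v, ε * max (M.shapley v) ψ < |n * s.1 v / (θ : ℝ) - M.shapley v| := hs
        refine Set.mem_iUnion.2 ⟨v, ?_⟩
        show ε * (θ * (max (M.shapley v) ψ / n)) < |s.1 v - θ * (M.shapley v / n)|
        have h1 : s.1 v - θ * (M.shapley v / n)
            = (n * s.1 v / (θ : ℝ) - M.shapley v) * (θ / n) := by field_simp
        rw [h1, abs_mul, abs_of_pos (show (0 : ℝ) < θ / n by positivity)]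
        calc ε * (θ * (max (M.shapley v) ψ / n)) = ε * max (M.shapley v) ψ * (θ / n) := by ring
          _ < _ := by gcongr
    _ ≤ ∑ v, (M.accumulate d θ 0 t).toOuterMeasure (B v) :=
        MeasureTheory.measure_iUnion_fintype_le _ _
    _ ≤ ∑ _v : Fin n, ENNReal.ofReal (2 * Real.exp (-phaseTwoExponent n l)) :=
        Finset.sum_le_sum fun v _ => hB v
    _ = ENNReal.ofReal (2 * (n * Real.exp (-phaseTwoExponent n l))) := by
        rw [mul_left_comm, ENNReal.ofReal_mul hn0.le]
        simp
    _ = _ := by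
        rw [mul_exp_neg_phaseTwoExponent hn]
        congr 1
        have hp : 0 < (n : ℝ) ^ l := Real.rpow_pos_of_pos hn0 l
        field_simp
        norm_num

theorem asvRR_robust {ε l : ℝ} (hε : 0 < ε) (hl : 0 < l) {k : ℕ}
    (hk : 1 ≤ k) (hkn : k ≤ n) (hψ : 1 ≤ kthLargest k M.shapley) :
    ENNReal.ofReal (1 - 1 / (n : ℝ) ^ l) ≤
      (M.asvRR d ε l k).toOuterMeasure
        {r | ∀ v : Fin n,
          (kthLargest k M.shapley < M.shapley v → |r.1 v - M.shapley v| ≤ ε * M.shapley v) ∧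
          (M.shapley v ≤ kthLargest k M.shapley →
            |r.1 v - M.shapley v| ≤ ε * kthLargest k M.shapley)} := by
  have hn := Nat.pos_of_ne_zero (NeZero.ne n)
  have hn0 : (0 : ℝ) < n := by positivity
  have hp : 0 < (n : ℝ) ^ l := Real.rpow_pos_of_pos hn0 l
  rw [ENNReal.ofReal_sub _ (by positivity), ENNReal.ofReal_one]
  refine PMF.one_sub_le_toOuterMeasure ?_
  set ψ := kthLargest k M.shapley with hψdef
  set δ := Real.sqrt 2 * ε
  have hδ : 0 < δ := sqrt_two_mul_pos hε
  calc _ ≤ (M.asvRR d ε l k).toOuterMeasure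
          {r | ∃ v, ε * max (M.shapley v) ψ < |r.1 v - M.shapley v|} := by
        refine MeasureTheory.measure_mono fun r hr => ?_
        by_contra hcon
        refine hr fun v => ?_
        have hv : |r.1 v - M.shapley v| ≤ ε * max (M.shapley v) ψ := by
          by_contra! h
          exact hcon ⟨v, h⟩
        refine ⟨fun h => ?_, fun h => ?_⟩
        · rwa [max_eq_left h.le] at hv
        · rwa [max_eq_right h] at hv
    _ = (M.phaseOne d δ l k (Nat.log 2 n - 1) 1 0 1).expect fun b =>
          (M.accumulate d (phaseTwoCount n ε l b.1) 0 (b.2 + 2)).toOuterMeasure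
            {s | ∃ v, ε * max (M.shapley v) ψ
              < |n * s.1 v / (phaseTwoCount n ε l b.1 : ℝ) - M.shapley v|} := by
        simp only [PMF.toOuterMeasure_eq_expect]
        rw [expect_asvRR]
        rfl
    _ ≤ (M.phaseOne d δ l k (Nat.log 2 n - 1) 1 0 1).expect fun b =>
          Set.indicator {y : ℝ | ψ < y} 1 b.1 + ENNReal.ofReal (1 / (2 * (n : ℝ) ^ l)) := by
        refine PMF.expect_mono_of_support fun b hb => ?_
        have h1 := M.one_le_of_mem_support_phaseOne d hδ l k _ 1 _ _ le_rfl
          two_pow_log_sub_one_le b hb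
        by_cases hb2 : b.1 ≤ ψ
        · exact le_add_left (M.phaseTwo_inaccurate_le d hε hl (by linarith) hb2 _)
        · refine le_add_right ?_
          rw [Set.indicator_of_mem (show b.1 ∈ {y : ℝ | ψ < y} from not_le.1 hb2)]
          exact PMF.toOuterMeasure_le_one _ _
    _ ≤ ENNReal.ofReal (1 / (2 * (n : ℝ) ^ l)) + ENNReal.ofReal (1 / (2 * (n : ℝ) ^ l)) := by
        rw [PMF.expect_add, PMF.expect_const]
        gcongr
        exact M.phaseOne_overshoot_le d hδ hl hk hkn hψ 1
    _ = ENNReal.ofReal (1 / (n : ℝ) ^ l) := by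
        rw [← ENNReal.ofReal_add (by positivity) (by positivity)]
        congr 1
        field_simp
        norm_num

end TriggeringModel

theorem phaseOneCount_mono {n : ℕ} (hn : 2 ≤ n) {δ l : ℝ} (hδ : 0 < δ) (hl : 0 < l) :
    Monotone (phaseOneCount n δ l) :=
  monotone_nat_of_le_succ fun i => phaseOneCount_le_succ hn hδ hl (Nat.succ_pos i)

theorem phaseTwoCount_anti {n : ℕ} {ε l LB LB' : ℝ} (hε : 0 < ε) (hl : 0 < l) (hLB : 0 < LB)
    (h : LB ≤ LB') : phaseTwoCount n ε l LB' ≤ phaseTwoCount n ε l LB := by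
  have := phaseTwoExponent_pos n hl
  rw [phaseTwoCount_eq, phaseTwoCount_eq]
  refine Nat.ceil_mono ?_
  gcongr

namespace TriggeringModel

variable {n : ℕ} (M : TriggeringModel n)

theorem stored_le (est : Fin n → ℝ) : stored est ≤ n := by
  exact (Finset.card_le_univ _).trans (by simp)

theorem stored_zero : stored (0 : Fin n → ℝ) = 0 := by simp [stored]

theorem stored_add_share_le (est : Fin n → ℝ) (R : Finset (Fin n)) :
    stored (est + share R) ≤ stored est + R.card := by
  unfold stored
  refine le_trans (Finset.card_le_card fun v hv => ?_) (Finset.card_union_le _ R)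
  simp only [Finset.mem_filter, Finset.mem_univ, true_and, Finset.mem_union, Pi.add_apply,
    share] at hv ⊢
  by_contra! h
  simp [h.1, h.2] at hv

theorem card_le_inDegree {v : Fin n} {T : Finset (Fin n)} (hT : T ∈ (M.trig v).support) :
    T.card ≤ M.inDegree v := by
  refine Finset.card_le_card_of_injOn (fun u => (u, v)) (fun u hu => ?_) fun a _ b _ h => ?_
  · simpa using M.trig_subset v T hT u hu
  · exact congrArg Prod.fst h

theorem sum_inDegree : ∑ v, M.inDegree v = M.E.card :=
  (Finset.card_eq_sum_card_fiberwise fun _ _ => Finset.mem_univ _).symm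

/-! ### The expected time of generating an RR set -/

theorem one_le_inDegreeSpread (hE : M.E.Nonempty) : 1 ≤ M.inDegreeSpread := by
  have hm : (M.E.card : ℝ) ≠ 0 := by exact_mod_cast hE.card_pos.ne'
  calc (1 : ℝ) = ∑ v, (M.inDegree v : ℝ) / (M.E.card : ℝ) := by
        rw [← Finset.sum_div, ← Nat.cast_sum, sum_inDegree, div_self hm]
    _ ≤ _ := Finset.sum_le_sum fun v _ =>
        le_mul_of_one_le_right (by positivity) (M.one_le_spread_singleton v)

theorem time_of_mem_support_grow (d : Fin n → ℝ≥0) (j : ℕ) :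
    ∀ (R D : Finset (Fin n)) (t : ℝ≥0), ∀ r ∈ (M.grow d j R D t).support,
      r.2 ≤ t + ∑ u ∈ r.1 \ D, (d u + 1 + M.inDegree u) ∧
      r.1.card ≤ R.card + ∑ u ∈ r.1 \ D, M.inDegree u := by
  induction j with
  | zero =>
    intro R D t r hr
    simp only [grow, PMF.support_pure, Set.mem_singleton_iff] at hr
    subst hr; exact ⟨le_self_add, Nat.le_add_right _ _⟩
  | succ j ih =>
    intro R D t r hr
    simp only [grow] at hr
    split_ifs at hr with h
    · obtain ⟨T, hT, hr⟩ := (PMF.mem_support_bind_iff _ _ _).1 hr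
      set u := (R \ D).min' h with hu
      have huR : u ∈ R \ D := (R \ D).min'_mem h
      have hur : u ∈ r.1 \ D := by
        rw [Finset.mem_sdiff] at huR ⊢
        exact ⟨M.subset_of_mem_support_grow d _ _ _ _ r hr (Finset.mem_union_left _ huR.1), huR.2⟩
      have hcard := M.card_le_inDegree hT
      obtain ⟨h1, h2⟩ := ih _ _ _ r hr
      rw [Finset.sdiff_insert] at h1 h2
      rw [← Finset.add_sum_erase _ _ hur, ← Finset.add_sum_erase _ (fun u => M.inDegree u) hur]
      constructor
      · have hcard' : (T.card : ℝ≥0) ≤ M.inDegree u := by exact_mod_cast hcard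
        calc r.2 ≤ _ := h1
          _ ≤ t + d u + 1 + M.inDegree u
                + ∑ w ∈ (r.1 \ D).erase u, (d w + 1 + M.inDegree w) := by gcongr
          _ = _ := by ring
      · have := Finset.card_union_le R T
        omega
    · simp only [PMF.support_pure, Set.mem_singleton_iff] at hr
      subst hr; exact ⟨le_self_add, Nat.le_add_right _ _⟩

variable [NeZero n] (d : Fin n → ℝ≥0)

/-- The expected time of generating an RR set `R` and updating the estimates of its nodes. -/
noncomputable def rrCost : ℝ≥0∞ :=
  (M.sampleRR d).expect fun r => ((r.2 + (r.1.card : ℝ≥0) + 1 : ℝ≥0) : ℝ≥0∞)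

/-- A node lies in a random RR set with probability `σ({v}) / n`, so that the expected number of
edges into an RR set is `m / n` times the expected spread of a node drawn by in-degree. Apart from
the root, the nodes of an RR set are sources of such edges. -/
theorem rrCost_le {c : ℝ} (hc : 0 < c) (hE : M.E.Nonempty)
    (hd : ∀ v, (d v : ℝ) ≤ c * M.inDegree v) :
    M.rrCost d ≤ ENNReal.ofReal ((c + 7) * ((M.E.card + n) / n * M.inDegreeSpread)) := by
  have hn0 : (0 : ℝ) < n := by exact_mod_cast Nat.pos_of_ne_zero (NeZero.ne n)
  have hm : (M.E.card : ℝ) ≠ 0 := by exact_mod_cast hE.card_pos.ne'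
  set g : Finset (Fin n) → ℝ := fun R =>
    4 + (c + 3) * ∑ u, (M.inDegree u : ℝ) * hitting R {u} with hg
  have hhit : ∀ (R : Finset (Fin n)), ∑ u, (M.inDegree u : ℝ) * hitting R {u}
      = ∑ u ∈ R, (M.inDegree u : ℝ) := by
    intro R
    have : ∀ u, hitting R {u} = if u ∈ R then 1 else 0 := by
      intro u
      unfold hitting
      congr 1
      simp [Finset.Nonempty]
    simp [this]
  have hg0 : ∀ R, 0 ≤ g R := by
    intro R
    simp only [hg, hhit]
    positivity
  calc M.rrCost d ≤ (M.sampleRR d).expect fun r => ENNReal.ofReal (g r.1) := by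
        refine PMF.expect_mono_of_support fun r hr => ?_
        obtain ⟨v, -, hv⟩ := (PMF.mem_support_bind_iff _ _ _).1 hr
        obtain ⟨h1, h2⟩ := M.time_of_mem_support_grow d _ _ _ _ r hv
        rw [Finset.sdiff_empty] at h1 h2
        rw [← ENNReal.ofReal_coe_nnreal]
        refine ENNReal.ofReal_le_ofReal ?_
        simp only [hg, hhit]
        have h1' : (r.2 : ℝ) ≤ 1 + ∑ u ∈ r.1, ((d u : ℝ) + 1 + M.inDegree u) := by
          exact_mod_cast h1
        have h2' : (r.1.card : ℝ) ≤ 1 + ∑ u ∈ r.1, (M.inDegree u : ℝ) := by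
          rw [Finset.card_singleton] at h2
          exact_mod_cast h2
        have h3 : ∑ u ∈ r.1, (d u : ℝ) ≤ c * ∑ u ∈ r.1, (M.inDegree u : ℝ) := by
          rw [Finset.mul_sum]
          exact Finset.sum_le_sum fun u _ => hd u
        simp only [Finset.sum_add_distrib, Finset.sum_const, nsmul_eq_mul, mul_one] at h1'
        push_cast
        linarith
    _ = ENNReal.ofReal ((∑ T, M.liveProb T * ∑ w, g (revReach T w)) / n) :=
        M.expect_sampleRR d hg0
    _ = ENNReal.ofReal (4 + (c + 3) * (M.E.card / n * M.inDegreeSpread)) := by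
        congr 1
        have h1 : ∑ T, M.liveProb T * ∑ w, ∑ u, (M.inDegree u : ℝ) * hitting (revReach T w) {u}
            = M.E.card * M.inDegreeSpread := by
          rw [inDegreeSpread, Finset.mul_sum]
          have h2 : ∀ T : Fin n → Finset (Fin n),
              ∑ w, ∑ u, (M.inDegree u : ℝ) * hitting (revReach T w) {u}
                = ∑ u, (M.inDegree u : ℝ) * ∑ w, hitting (revReach T w) {u} := by
            intro T
            rw [Finset.sum_comm]
            simp only [Finset.mul_sum]
          simp only [h2, Finset.mul_sum Finset.univ _ (M.liveProb _)]
          rw [Finset.sum_comm]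
          refine Finset.sum_congr rfl fun u _ => ?_
          rw [spread_eq, ← mul_assoc, mul_div_cancel₀ _ hm, Finset.mul_sum]
          exact Finset.sum_congr rfl fun T _ => by ring
        simp only [hg, Finset.sum_add_distrib, ← Finset.mul_sum, mul_add, mul_left_comm _ (c + 3),
          h1]
        simp only [Finset.sum_const, Finset.card_univ, Fintype.card_fin, nsmul_eq_mul,
          ← Finset.sum_mul, sum_liveProb]
        field_simp
    _ ≤ _ := by
        refine ENNReal.ofReal_le_ofReal ?_
        have hI := M.one_le_inDegreeSpread hE
        have h3 : (0 : ℝ) ≤ M.E.card / n := by positivity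
        have h4 : ((M.E.card : ℝ) + n) / n = M.E.card / n + 1 := by field_simp
        rw [h4]
        nlinarith [mul_nonneg h3 (zero_le_one.trans hI), mul_nonneg hc.le (zero_le_one.trans hI)]

theorem expect_accumulate_time (j : ℕ) :
    ∀ (est : Fin n → ℝ) (t : ℝ≥0),
      ((M.accumulate d j est t).expect fun s => (s.2 : ℝ≥0∞)) = t + j * M.rrCost d := by
  induction j with
  | zero => intro est t; simp only [accumulate, PMF.expect_pure]; simp
  | succ j ih =>
    intro est t
    rw [accumulate_succ, PMF.expect_bind]
    simp only [ih]
    have h : ∀ r : Finset (Fin n) × ℝ≥0,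
        ((t + r.2 + (r.1.card : ℝ≥0) + 1 : ℝ≥0) : ℝ≥0∞) + j * M.rrCost d
          = (t + j * M.rrCost d) + ((r.2 + (r.1.card : ℝ≥0) + 1 : ℝ≥0) : ℝ≥0∞) := by
      intro r; push_cast; ring
    simp only [h]
    rw [PMF.expect_add, PMF.expect_const, ← rrCost]
    push_cast
    ring

theorem expect_accumulate_stored (j : ℕ) :
    ∀ (est : Fin n → ℝ) (t : ℝ≥0),
      ((M.accumulate d j est t).expect fun s => (stored s.1 : ℝ≥0∞))
        ≤ stored est + j * M.rrCost d := by
  induction j with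
  | zero => intro est t; simp only [accumulate, PMF.expect_pure]; simp
  | succ j ih =>
    intro est t
    rw [accumulate_succ, PMF.expect_bind]
    calc _ ≤ (M.sampleRR d).expect fun r => (stored est + j * M.rrCost d)
            + ((r.2 + (r.1.card : ℝ≥0) + 1 : ℝ≥0) : ℝ≥0∞) := by
          refine PMF.expect_mono fun r => (ih _ _).trans ?_
          have h : (stored (est + share r.1) : ℝ≥0∞) ≤ stored est + r.1.card := by
            exact_mod_cast stored_add_share_le est r.1
          calc _ ≤ ((stored est : ℝ≥0∞) + r.1.card) + j * M.rrCost d := by gcongr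
            _ = (stored est + j * M.rrCost d) + r.1.card := by ring
            _ ≤ _ := by
              gcongr
              push_cast
              rw [add_assoc]
              exact le_add_left le_self_add
      _ = _ := by
          rw [PMF.expect_add, PMF.expect_const, ← rrCost]
          push_cast
          ring

/-! ### The expected running time in terms of the number of RR sets -/

theorem expect_asvRR_time_le (ε l : ℝ) (k : ℕ) :
    ((M.asvRR d ε l k).expect fun r => (r.2 : ℝ≥0∞))
      ≤ (M.phaseOne d (Real.sqrt 2 * ε) l k (Nat.log 2 n - 1) 1 0 1).expect fun b =>
          3 + (b.2 + 2 * phaseTwoCount n ε l b.1 * M.rrCost d) := by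
  rw [expect_asvRR]
  refine PMF.expect_mono fun b => ?_
  simp only [ENNReal.coe_add, PMF.expect_add, PMF.expect_const, expect_accumulate_time]
  have h := M.expect_accumulate_stored d (phaseTwoCount n ε l b.1) 0 (b.2 + 2)
  rw [stored_zero, Nat.cast_zero, zero_add] at h
  calc _ ≤ ((b.2 : ℝ≥0∞) + 2 + phaseTwoCount n ε l b.1 * M.rrCost d)
          + phaseTwoCount n ε l b.1 * M.rrCost d + 1 := by
        push_cast
        gcongr
    _ = _ := by ring

/-- The worst case of Phase 1: all iterations take place and all nodes have estimates. -/
theorem expect_phaseOne_time_le (hn : 2 ≤ n) {δ l : ℝ} (hδ : 0 < δ) (hl : 0 < l) (k j : ℕ) :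
    ∀ (i : ℕ) (est : Fin n → ℝ) (t : ℝ≥0), 1 ≤ i →
      ((M.phaseOne d δ l k j i est t).expect fun b => (b.2 : ℝ≥0∞))
        ≤ t + (phaseOneCount n δ l (i + j - 1) - phaseOneCount n δ l (i - 1) : ℕ) * M.rrCost d
          + j * (n + 2) := by
  induction j with
  | zero => intro i est t _; simp only [phaseOne, PMF.expect_pure]; simp
  | succ j ih =>
    intro i est t hi
    have hmono := phaseOneCount_mono (l := l) hn hδ hl
    have h1 : phaseOneCount n δ l (i - 1) ≤ phaseOneCount n δ l i := hmono (by omega)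
    have h2 : phaseOneCount n δ l i ≤ phaseOneCount n δ l (i + j) := hmono (by omega)
    rw [expect_phaseOne_succ]
    have hst : ∀ s : (Fin n → ℝ) × ℝ≥0,
        ((s.2 + (stored s.1 : ℝ≥0) + 2 : ℝ≥0) : ℝ≥0∞) ≤ s.2 + (n + 2) := by
      intro s
      have : (stored s.1 : ℝ≥0∞) ≤ n := by exact_mod_cast stored_le s.1
      push_cast
      rw [add_assoc]
      gcongr
    calc _ ≤ (M.accumulate d (phaseOneCount n δ l i - phaseOneCount n δ l (i - 1)) est t).expect
            fun s => (s.2 : ℝ≥0∞) + ((n + 2) +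
              ((phaseOneCount n δ l (i + j) - phaseOneCount n δ l i : ℕ) * M.rrCost d
                + j * (n + 2))) := by
          refine PMF.expect_mono fun s => ?_
          rw [← add_assoc]
          split_ifs
          · exact le_add_right (hst s)
          · refine (ih (i + 1) _ _ (by omega)).trans ?_
            rw [show i + 1 + j - 1 = i + j by omega, Nat.add_sub_cancel, add_assoc]
            exact add_le_add_left (hst s) _
      _ = t + ((phaseOneCount n δ l i - phaseOneCount n δ l (i - 1) : ℕ)
              + (phaseOneCount n δ l (i + j) - phaseOneCount n δ l i : ℕ)) * M.rrCost d
            + (j + 1) * (n + 2) := by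
          rw [PMF.expect_add, PMF.expect_const, expect_accumulate_time]
          ring
      _ = _ := by
          rw [← Nat.cast_add, show i + (j + 1) - 1 = i + j by omega]
          congr 4
          · omega
          · push_cast; rfl

theorem expect_phaseOne_time_add (δ l : ℝ) (k : ℕ) (H : ℝ → ℝ≥0∞) (j i : ℕ) (est : Fin n → ℝ)
    (t : ℝ≥0) :
    ((M.phaseOne d δ l k j i est t).expect fun b => b.2 + H b.1)
      = t + (M.phaseOne d δ l k j i est 0).expect fun b => b.2 + H b.1 := by
  have h := M.expect_phaseOne_add_time d δ l k (fun b => b.2 + H b.1) t j i est 0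
  rw [add_zero] at h
  rw [h]
  simp only [ENNReal.coe_add, add_assoc]
  rw [PMF.expect_add, PMF.expect_const]

/-- One iteration of the loop, entered with the RR sets of the previous iterations. The estimates
kept in the table are paid for by all RR sets generated up to now. -/
theorem expect_phaseOne_step (hn : 2 ≤ n) {δ l : ℝ} (hδ : 0 < δ) (hl : 0 < l) (k : ℕ)
    (H : ℝ → ℝ≥0∞) (j : ℕ) {i : ℕ} (hi : 1 ≤ i) :
    ((M.accumulate d (phaseOneCount n δ l (i - 1)) 0 0).expect fun s =>
        (M.phaseOne d δ l k (j + 1) i s.1 0).expect fun b => b.2 + H b.1)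
      ≤ 2 * phaseOneCount n δ l i * M.rrCost d + 2
        + (M.accumulate d (phaseOneCount n δ l i) 0 0).expect fun s =>
          if (1 + δ) * phaseOneTarget n i
              ≤ (n : ℝ) * kthLargest k s.1 / (phaseOneCount n δ l i : ℝ) then
            H ((n : ℝ) * kthLargest k s.1 / ((phaseOneCount n δ l i : ℝ) * (1 + δ)))
          else (M.phaseOne d δ l k j (i + 1) s.1 0).expect fun b => b.2 + H b.1 := by
  set θ := phaseOneCount n δ l i with hθ
  set N : (Fin n → ℝ) → ℝ≥0∞ := fun est =>
    if (1 + δ) * phaseOneTarget n i ≤ (n : ℝ) * kthLargest k est / (θ : ℝ) then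
      H ((n : ℝ) * kthLargest k est / ((θ : ℝ) * (1 + δ)))
    else (M.phaseOne d δ l k j (i + 1) est 0).expect fun b => b.2 + H b.1 with hN
  set Δ := θ - phaseOneCount n δ l (i - 1) with hΔ
  have hstep : ∀ est : Fin n → ℝ,
      ((M.phaseOne d δ l k (j + 1) i est 0).expect fun b => b.2 + H b.1)
        = Δ * M.rrCost d
          + (M.accumulate d Δ est 0).expect fun s => (stored s.1 : ℝ≥0∞) + 2 + N s.1 := by
    intro est
    have h := M.expect_accumulate_time d Δ est 0
    rw [ENNReal.coe_zero, zero_add] at h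
    rw [← h, ← PMF.expect_add, expect_phaseOne_succ]
    congr 1
    funext s
    simp only [hN]
    split_ifs
    · push_cast; ring
    · rw [expect_phaseOne_time_add]
      push_cast; ring
  have hst := M.expect_accumulate_stored d θ 0 0
  rw [stored_zero, Nat.cast_zero, zero_add] at hst
  simp only [hstep]
  rw [PMF.expect_add, PMF.expect_const,
    M.expect_accumulate_phaseOneCount d hn hδ hl hi fun est => (stored est : ℝ≥0∞) + 2 + N est]
  rw [PMF.expect_add (M.accumulate d θ 0 0), PMF.expect_add (M.accumulate d θ 0 0),
    PMF.expect_const]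
  have hΔθ : (Δ : ℝ≥0∞) ≤ θ := by exact_mod_cast Nat.sub_le _ _
  calc _ ≤ (θ : ℝ≥0∞) * M.rrCost d + ((θ : ℝ≥0∞) * M.rrCost d + 2
          + (M.accumulate d θ 0 0).expect fun s => N s.1) := by gcongr
    _ = 2 * θ * M.rrCost d + 2 + (M.accumulate d θ 0 0).expect fun s => N s.1 := by ring

/-- The loop up to a critical iteration `I`. The continuation cost `H` vanishes for bounds that come
from the iterations up to `I`, and after a failure of the test in iteration `I` the worst case `W` is
charged. -/
theorem expect_phaseOne_le (hn : 2 ≤ n) {δ l : ℝ} (hδ : 0 < δ) (hl : 0 < l) (k : ℕ)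
    (H : ℝ → ℝ≥0∞) {I J : ℕ} (hIJ : I ≤ J) (hH : ∀ y, phaseOneTarget n I ≤ y → H y = 0)
    {a p W : ℝ≥0∞}
    (ha : ∀ i, 1 ≤ i → 2 * phaseOneCount n δ l i * M.rrCost d + 2 ≤ a * (2 ^ i : ℕ))
    (hp : (M.accumulate d (phaseOneCount n δ l I) 0 0).toOuterMeasure
      {s | ¬ (1 + δ) * phaseOneTarget n I
        ≤ (n : ℝ) * kthLargest k s.1 / (phaseOneCount n δ l I : ℝ)} ≤ p)
    (hW : ∀ est, ((M.phaseOne d δ l k (J - I) (I + 1) est 0).expect fun b => b.2 + H b.1) ≤ W)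
    (q : ℕ) :
    ∀ i, 1 ≤ i → i + q = I →
      ((M.accumulate d (phaseOneCount n δ l (i - 1)) 0 0).expect fun s =>
          (M.phaseOne d δ l k (J + 1 - i) i s.1 0).expect fun b => b.2 + H b.1)
        ≤ a * (2 ^ (I + 1) - 2 ^ i : ℕ) + p * W := by
  induction q with
  | zero =>
    intro i hi hiI
    obtain rfl : i = I := by omega
    rw [show J + 1 - i = (J - i) + 1 by omega]
    refine (M.expect_phaseOne_step d hn hδ hl k H (J - i) hi).trans ?_
    refine add_le_add ((ha i hi).trans (by rw [pow_succ, mul_two, Nat.add_sub_cancel])) ?_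
    refine le_trans ?_ (mul_le_mul_left hp W)
    rw [PMF.toOuterMeasure_eq_expect, ← PMF.expect_mul_const]
    refine PMF.expect_mono fun s => ?_
    by_cases h : (1 + δ) * phaseOneTarget n i
        ≤ (n : ℝ) * kthLargest k s.1 / (phaseOneCount n δ l i : ℝ)
    · rw [if_pos h, hH _ (le_phaseOne_bound hδ h)]
      exact zero_le
    · rw [if_neg h, Set.indicator_of_mem h]
      simpa using hW s.1
  | succ q ih =>
    intro i hi hiI
    rw [show J + 1 - i = (J + 1 - (i + 1)) + 1 by omega]
    refine (M.expect_phaseOne_step d hn hδ hl k H (J + 1 - (i + 1)) hi).trans ?_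
    have hpow : (2 ^ (I + 1) - 2 ^ i : ℕ) = 2 ^ i + (2 ^ (I + 1) - 2 ^ (i + 1)) := by
      have h1 : 2 ^ (i + 1) ≤ 2 ^ (I + 1) := Nat.pow_le_pow_right two_pos (by omega)
      have h2 : 2 ^ (i + 1) = 2 ^ i + 2 ^ i := by ring
      have h3 := Nat.two_pow_pos i
      omega
    rw [hpow, Nat.cast_add, mul_add a, add_assoc (a * _)]
    refine add_le_add (ha i hi) (le_trans (PMF.expect_mono fun s => ?_)
      (ih (i + 1) (by omega) (by omega)))
    split_ifs with h
    · have hx : phaseOneTarget n I ≤ phaseOneTarget n i := by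
        unfold phaseOneTarget
        gcongr
        · norm_num
        · omega
      rw [hH _ (hx.trans (le_phaseOne_bound hδ h))]
      exact zero_le
    · exact le_rfl

theorem expect_phaseOne_time_add_le (hn : 2 ≤ n) {δ l : ℝ} (hδ : 0 < δ) (hl : 0 < l) (k : ℕ)
    {H : ℝ → ℝ≥0∞} {h : ℝ≥0∞} (hH : ∀ y, 1 ≤ y → H y ≤ h) {i j J : ℕ} (hi : 1 ≤ i)
    (hij : i + j = J + 1) (hJ : 2 ^ J ≤ n) (est : Fin n → ℝ) (t : ℝ≥0) :
    ((M.phaseOne d δ l k j i est t).expect fun b => b.2 + H b.1)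
      ≤ t + (phaseOneCount n δ l J * M.rrCost d + J * (n + 2)) + h := by
  rw [PMF.expect_add]
  refine add_le_add ((M.expect_phaseOne_time_le d hn hδ hl k j i est t hi).trans ?_) ?_
  · rw [add_assoc, show i + j - 1 = J by omega]
    gcongr
    · exact Nat.sub_le _ _
    · omega
  · rw [← (M.phaseOne d δ l k j i est t).expect_const h]
    refine PMF.expect_mono_of_support fun b hb => hH _ ?_
    exact M.one_le_of_mem_support_phaseOne d hδ l k j i est t hi
      (by rwa [show i + j - 1 = J by omega]) b hb

/-- The worst case of the algorithm. -/
theorem expect_asvRR_time_le_worst (hn : 2 ≤ n) {ε l : ℝ} (hε : 0 < ε) (hl : 0 < l) (k : ℕ)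
    {J : ℕ} (hJ : J = Nat.log 2 n - 1) {K : ℝ≥0} (hK : M.rrCost d ≤ K) :
    ((M.asvRR d ε l k).expect fun r => (r.2 : ℝ≥0∞))
      ≤ ((4 + (phaseOneCount n (Real.sqrt 2 * ε) l J * K + J * (n + 2))
          + 2 * phaseTwoCount n ε l 1 * K : ℝ≥0) : ℝ≥0∞) := by
  refine (M.expect_asvRR_time_le d ε l k).trans ?_
  have hJn : 2 ^ J ≤ n := by
    rw [hJ]
    simpa using two_pow_log_sub_one_le (n := n)
  have h := M.expect_phaseOne_time_add_le d hn (sqrt_two_mul_pos hε) hl k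
    (H := fun y => 2 * phaseTwoCount n ε l y * M.rrCost d)
    (h := 2 * phaseTwoCount n ε l 1 * K) (fun y hy => by
      gcongr
      exact phaseTwoCount_anti hε hl one_pos hy) (i := 1) (j := J) (J := J) le_rfl
      (add_comm _ _) hJn 0 1
  rw [PMF.expect_add, PMF.expect_const, ← hJ]
  calc _ ≤ _ := add_le_add le_rfl h
    _ ≤ 3 + (((1 : ℝ≥0) : ℝ≥0∞)
          + (phaseOneCount n (Real.sqrt 2 * ε) l J * (K : ℝ≥0∞) + J * (n + 2))
          + 2 * phaseTwoCount n ε l 1 * K) := by gcongr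
    _ = _ := by push_cast; ring

/-- The expected running time if the test of iteration `I` fails with probability at most `p`. -/
theorem expect_asvRR_time_le_of_test (hn : 2 ≤ n) {ε l : ℝ} (hε : 0 < ε) (hl : 0 < l) (k : ℕ)
    {I J : ℕ} (hI : 1 ≤ I) (hIJ : I ≤ J) (hJ : J = Nat.log 2 n - 1) {K a p : ℝ≥0}
    (hK : M.rrCost d ≤ K)
    (ha : ∀ i, 1 ≤ i → 2 * (phaseOneCount n (Real.sqrt 2 * ε) l i : ℝ≥0) * K + 2 ≤ a * 2 ^ i)
    (hp : (M.accumulate d (phaseOneCount n (Real.sqrt 2 * ε) l I) 0 0).toOuterMeasure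
      {s | ¬ (1 + Real.sqrt 2 * ε) * phaseOneTarget n I
        ≤ (n : ℝ) * kthLargest k s.1 / (phaseOneCount n (Real.sqrt 2 * ε) l I : ℝ)} ≤ p) :
    ((M.asvRR d ε l k).expect fun r => (r.2 : ℝ≥0∞))
      ≤ ((4 + 2 * phaseTwoCount n ε l (phaseOneTarget n I) * K + a * 2 ^ (I + 1)
          + p * (phaseOneCount n (Real.sqrt 2 * ε) l J * K + J * (n + 2)
            + 2 * phaseTwoCount n ε l 1 * K) : ℝ≥0) : ℝ≥0∞) := by
  set δ := Real.sqrt 2 * ε with hδdef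
  have hδ : 0 < δ := sqrt_two_mul_pos hε
  have hJn : 2 ^ J ≤ n := by
    rw [hJ]
    simpa using two_pow_log_sub_one_le (n := n)
  have hx := phaseOneTarget_pos (show 1 ≤ n by omega) I
  set x := phaseOneTarget n I with hxdef
  let H : ℝ → ℝ≥0∞ := fun y => if x ≤ y then 0 else 2 * phaseTwoCount n ε l 1 * K
  have hH : ∀ y, x ≤ y → H y = 0 := fun y hy => if_pos hy
  have hH1 : ∀ y, 1 ≤ y → H y ≤ 2 * phaseTwoCount n ε l 1 * K := by
    intro y _
    simp only [H]
    split_ifs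
    · exact zero_le
    · exact le_rfl
  have hcount : ∀ y, 1 ≤ y → 2 * (phaseTwoCount n ε l y : ℝ≥0∞) * M.rrCost d
      ≤ 2 * phaseTwoCount n ε l x * K + H y := by
    intro y hy
    simp only [H]
    split_ifs with hxy
    · rw [add_zero]
      gcongr
      exact phaseTwoCount_anti hε hl hx hxy
    · refine le_add_left ?_
      gcongr
      exact phaseTwoCount_anti hε hl one_pos hy
  have hloop := M.expect_phaseOne_le d hn hδ hl k H hIJ hH (a := a) (p := p)
    (W := phaseOneCount n δ l J * K + J * (n + 2) + 2 * phaseTwoCount n ε l 1 * K)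
    (fun i hi => le_trans (by gcongr) (by exact_mod_cast ha i hi :
      2 * (phaseOneCount n δ l i : ℝ≥0∞) * K + 2 ≤ a * (2 ^ i : ℕ))) hp
    (fun est => (M.expect_phaseOne_time_add_le d hn hδ hl k hH1 (i := I + 1) (j := J - I)
      (by omega) (by omega) hJn est 0).trans (by
        rw [ENNReal.coe_zero, zero_add]
        gcongr)) (I - 1) 1 le_rfl (by omega)
  have h0 : phaseOneCount n δ l 0 = 0 := by simp [phaseOneCount]
  simp only [Nat.sub_self, h0, accumulate, PMF.expect_pure, Nat.add_sub_cancel] at hloop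
  refine (M.expect_asvRR_time_le d ε l k).trans ?_
  rw [PMF.expect_add, PMF.expect_const, ← hJ]
  calc _ ≤ 3 + ((M.phaseOne d δ l k J 1 0 1).expect fun b =>
            2 * (phaseTwoCount n ε l x : ℝ≥0∞) * K + (b.2 + H b.1)) := by
        refine add_le_add le_rfl (PMF.expect_mono_of_support fun b hb => ?_)
        have hb1 := M.one_le_of_mem_support_phaseOne d hδ l k J 1 0 1 le_rfl
          (by simpa using hJn) b hb
        calc _ ≤ (b.2 : ℝ≥0∞) + (2 * phaseTwoCount n ε l x * K + H b.1) := by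
              gcongr
              exact hcount _ hb1
          _ = _ := by ring
    _ = 3 + (2 * (phaseTwoCount n ε l x : ℝ≥0∞) * K
          + (1 + (M.phaseOne d δ l k J 1 0 0).expect fun b => b.2 + H b.1)) := by
        rw [PMF.expect_add, PMF.expect_const, expect_phaseOne_time_add, ENNReal.coe_one]
    _ ≤ 3 + (2 * (phaseTwoCount n ε l x : ℝ≥0∞) * K
          + (1 + (a * (2 ^ (I + 1) : ℕ) + p * (phaseOneCount n δ l J * K + J * (n + 2)
            + 2 * phaseTwoCount n ε l 1 * K)))) := by
        gcongr
        refine hloop.trans ?_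
        gcongr
        exact Nat.sub_le _ _
    _ = _ := by push_cast; ring

end TriggeringModel

/-! ### The final estimate -/

section Arithmetic

variable {n : ℕ} {ε ε₀ l l₀ : ℝ}

/-- The factor `ln n` in the sample sizes absorbs `log₂ n` and constants. -/
theorem logb_two_le (hn : 2 ≤ n) (hε : 0 < ε) (hεε : ε ≤ ε₀) (hl₀ : 0 < l₀) (hl : l₀ ≤ l) :
    Real.logb 2 n ≤ ε₀ ^ 2 / (l₀ * Real.log 2) * (l * Real.log n / ε ^ 2) := by
  have h2 : 0 < Real.log 2 := Real.log_pos (by norm_num)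
  have hL : 0 < Real.log n := Real.log_pos (by exact_mod_cast hn)
  have hsq : ε ^ 2 ≤ ε₀ ^ 2 := by gcongr
  calc Real.logb 2 n = ε ^ 2 / (l₀ * Real.log 2) * (l₀ * Real.log n / ε ^ 2) := by
        rw [Real.logb]; field_simp
    _ ≤ _ := by gcongr

theorem exponent_le (hn : 2 ≤ n) (hl₀ : 0 < l₀) (hl : l₀ ≤ l) :
    (l + 3) * Real.log n ≤ (1 + 3 / l₀) * (l * Real.log n) := by
  have hL : 0 < Real.log n := Real.log_pos (by exact_mod_cast hn)
  have : 3 ≤ 3 / l₀ * l := by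
    rw [div_mul_eq_mul_div, le_div_iff₀ hl₀]
    linarith
  nlinarith

theorem log_two_le_log (hn : 2 ≤ n) : Real.log 2 ≤ Real.log n :=
  Real.log_le_log two_pos (by exact_mod_cast hn)

theorem phaseOneExponent_le_mul (hn : 2 ≤ n) (hl₀ : 0 < l₀) (hl : l₀ ≤ l) :
    phaseOneExponent n l ≤ (1 + 3 / l₀) * (l * Real.log n) := by
  refine le_trans ?_ (exponent_le hn hl₀ hl)
  have hn0 : (0 : ℝ) < n := by positivity
  have h1 : Real.logb 2 n ≤ n := by
    rw [Real.logb_le_iff_le_rpow (by norm_num) hn0, Real.rpow_natCast]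
    exact_mod_cast Nat.lt_two_pow_self.le
  have h2 : Real.log (Real.logb 2 n) ≤ Real.log n :=
    Real.log_le_log (zero_lt_one.trans_le (one_le_logb_two hn)) h1
  have h3 := log_two_le_log hn
  unfold phaseOneExponent
  linarith

theorem phaseTwoExponent_le_mul (hn : 2 ≤ n) (hl₀ : 0 < l₀) (hl : l₀ ≤ l) :
    phaseTwoExponent n l ≤ (1 + 3 / l₀) * (l * Real.log n) := by
  refine le_trans ?_ (exponent_le hn hl₀ hl)
  have h3 := log_two_le_log hn
  have h4 : Real.log 4 = 2 * Real.log 2 := by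
    rw [show (4 : ℝ) = 2 ^ 2 by norm_num, Real.log_pow]
    norm_num
  unfold phaseTwoExponent
  linarith

/-- The constant in the bounds for the sample sizes of both phases. -/
noncomputable def sampleConstant (ε₀ l₀ : ℝ) : ℝ :=
  (1 + 3 / l₀) * (2 + ε₀) + ε₀ ^ 2 / (l₀ * Real.log 2)

theorem ceil_le_sampleConstant (hn : 2 ≤ n) (hε : 0 < ε) (hεε : ε ≤ ε₀) (hl₀ : 0 < l₀)
    (hl : l₀ ≤ l) {A y : ℝ} (hy : 1 ≤ y)
    (hA : 0 ≤ A) (h : A ≤ (1 + 3 / l₀) * (2 + ε₀) * (l * Real.log n / ε ^ 2) * y) :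
    (⌈A⌉₊ : ℝ) ≤ sampleConstant ε₀ l₀ * (l * Real.log n / ε ^ 2) * y := by
  have h1 := (one_le_logb_two hn).trans (logb_two_le hn hε hεε hl₀ hl)
  have h2 := (Nat.ceil_lt_add_one hA).le
  unfold sampleConstant
  nlinarith

theorem phaseOneCount_le (hn : 2 ≤ n) (hε : 0 < ε) (hεε : ε ≤ ε₀) (hl₀ : 0 < l₀)
    (hl : l₀ ≤ l) {i : ℕ} (hi : 1 ≤ i) :
    (phaseOneCount n (Real.sqrt 2 * ε) l i : ℝ)
      ≤ sampleConstant ε₀ l₀ * (l * Real.log n / ε ^ 2) * 2 ^ i := by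
  have hn0 : (0 : ℝ) < n := by positivity
  have hL : 0 < Real.log n := Real.log_pos (by exact_mod_cast hn)
  have hl' : 0 < l := hl₀.trans_le hl
  have hε₀ : 0 < ε₀ := hε.trans_le hεε
  have hδ := sqrt_two_mul_pos hε
  have hexp := (phaseOneExponent_pos hn hl').le
  have hx := phaseOneTarget_pos (show 1 ≤ n by omega) i
  rw [phaseOneCount_of_pos hi]
  refine ceil_le_sampleConstant hn hε hεε hl₀ hl (one_le_pow₀ one_le_two) (by positivity) ?_
  have hsq : Real.sqrt 2 ≤ 2 := by
    rw [Real.sqrt_le_left (by norm_num)]; norm_num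
  have h1 : (2 + 2 / 3 * (Real.sqrt 2 * ε)) ≤ 2 * (2 + ε₀) := by nlinarith
  calc (n : ℝ) * phaseOneExponent n l * (2 + 2 / 3 * (Real.sqrt 2 * ε))
        / ((Real.sqrt 2 * ε) ^ 2 * phaseOneTarget n i)
      = phaseOneExponent n l * (2 + 2 / 3 * (Real.sqrt 2 * ε)) / (2 * ε ^ 2) * 2 ^ i := by
        rw [mul_pow, Real.sq_sqrt two_pos.le, phaseOneTarget]
        field_simp
    _ ≤ (1 + 3 / l₀) * (l * Real.log n) * (2 * (2 + ε₀)) / (2 * ε ^ 2) * 2 ^ i := by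
        gcongr
        exact phaseOneExponent_le_mul hn hl₀ hl
    _ = _ := by field_simp

theorem phaseTwoCount_le (hn : 2 ≤ n) (hε : 0 < ε) (hεε : ε ≤ ε₀) (hl₀ : 0 < l₀)
    (hl : l₀ ≤ l) {LB : ℝ} (hLB : 0 < LB) (hLBn : LB ≤ n) :
    (phaseTwoCount n ε l LB : ℝ)
      ≤ sampleConstant ε₀ l₀ * (l * Real.log n / ε ^ 2) * (n / LB) := by
  have hn0 : (0 : ℝ) < n := by positivity
  have hL : 0 < Real.log n := Real.log_pos (by exact_mod_cast hn)
  have hl' : 0 < l := hl₀.trans_le hl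
  have hε₀ : 0 < ε₀ := hε.trans_le hεε
  have hexp := (phaseTwoExponent_pos n hl').le
  rw [phaseTwoCount_eq]
  refine ceil_le_sampleConstant hn hε hεε hl₀ hl ((one_le_div hLB).2 hLBn) (by positivity) ?_
  have h1 : (2 + 2 / 3 * ε) ≤ 2 + ε₀ := by linarith
  calc (n : ℝ) * phaseTwoExponent n l * (2 + 2 / 3 * ε) / (ε ^ 2 * LB)
      ≤ n * ((1 + 3 / l₀) * (l * Real.log n)) * (2 + ε₀) / (ε ^ 2 * LB) := by
        gcongr
        exact phaseTwoExponent_le_mul hn hl₀ hl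
    _ = _ := by field_simp

end Arithmetic

namespace TriggeringModel

variable {n : ℕ} (M : TriggeringModel n) [NeZero n] (d : Fin n → ℝ≥0)

/-- If `ψ^(k)` exceeds the target by a large factor, then the test fails only if one of `k` nodes
with centrality at least `ψ^(k)` gets less than half of its expected estimate. -/
theorem accumulate_test_fails_le (hn : 2 ≤ n) {δ l : ℝ} (hδ : 0 < δ) (hl : 0 < l) {k : ℕ}
    (hk : 1 ≤ k) (hkn : k ≤ n) {i : ℕ} (hi : 1 ≤ i)
    (hψ : 12 * (1 + δ) * phaseOneTarget n i ≤ kthLargest k M.shapley) :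
    (M.accumulate d (phaseOneCount n δ l i) 0 0).toOuterMeasure
        {s | ¬ (1 + δ) * phaseOneTarget n i
          ≤ (n : ℝ) * kthLargest k s.1 / (phaseOneCount n δ l i : ℝ)}
      ≤ (((k : ℝ≥0) / n : ℝ≥0) : ℝ≥0∞) := by
  have hn0 : (0 : ℝ) < n := by positivity
  have hexp := phaseOneExponent_le (l := l) hn hδ hi
  have hθ0 : (0 : ℝ) < phaseOneCount n δ l i := by exact_mod_cast phaseOneCount_pos hn hδ hl hi
  set θ := phaseOneCount n δ l i with hθ
  have hx0 := phaseOneTarget_pos (show 1 ≤ n by omega) i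
  set x := phaseOneTarget n i with hx
  obtain ⟨S, hS, hcard⟩ := Finset.exists_subset_card_eq (le_card_kthLargest_le hk hkn M.shapley)
  have hSψ : ∀ v ∈ S, 12 * (1 + δ) * x ≤ M.shapley v := fun v hv =>
    hψ.trans (by simpa using hS hv)
  let B : Fin n → Set ((Fin n → ℝ) × ℝ≥0) := fun v =>
    {s | s.1 v ≤ θ * (M.shapley v / n) - 1 / 2 * (θ * (M.shapley v / n))}
  have hsmall : n * Real.exp (-phaseOneExponent n l) ≤ 1 := by
    rw [mul_exp_neg_phaseOneExponent hn]
    have h1 : 1 ≤ (n : ℝ) ^ l := Real.one_le_rpow (by exact_mod_cast (by omega : 1 ≤ n)) hl.le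
    have h2 := one_le_logb_two hn
    rw [div_le_one (by positivity)]
    nlinarith
  have hB : ∀ v ∈ S, (M.accumulate d θ 0 0).toOuterMeasure (B v) ≤ ENNReal.ofReal (1 / n) := by
    intro v hv
    refine (M.accumulate_lower_tail d v θ 0 (by norm_num) le_rfl).trans
      (ENNReal.ofReal_le_ofReal ?_)
    rw [le_div_iff₀ hn0, mul_comm]
    refine le_trans ?_ hsmall
    gcongr
    refine hexp.trans ?_
    have h1 : δ ^ 2 / (2 + 2 / 3 * δ) ≤ 12 * (1 + δ) / 8 := by
      rw [div_le_div_iff₀ (by positivity) (by norm_num)]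
      nlinarith
    calc δ ^ 2 / (2 + 2 / 3 * δ) * (θ * (x / n)) ≤ 12 * (1 + δ) / 8 * (θ * (x / n)) := by gcongr
      _ = 1 / 8 * (θ * (12 * (1 + δ) * x / n)) := by ring
      _ ≤ 1 / 8 * (θ * (M.shapley v / n)) := by
        gcongr
        exact hSψ v hv
      _ = _ := by ring
  calc _ ≤ (M.accumulate d θ 0 0).toOuterMeasure (⋃ v ∈ S, B v) := by
        refine MeasureTheory.measure_mono fun s hs => ?_
        by_contra hcon
        refine hs ?_
        have hlow : ∀ v ∈ S, (1 + δ) * x * θ / n ≤ s.1 v := by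
          intro v hv
          have hv' : s ∉ B v := fun h => hcon (Set.mem_biUnion hv h)
          have hv2 : θ * (M.shapley v / n) - 1 / 2 * (θ * (M.shapley v / n)) < s.1 v :=
            not_le.1 hv'
          have h3 : θ * (12 * (1 + δ) * x / n) ≤ θ * (M.shapley v / n) := by
            gcongr
            exact hSψ v hv
          have h4 : (1 + δ) * x * θ / n = 1 / 12 * (θ * (12 * (1 + δ) * x / n)) := by ring
          have h5 : 0 ≤ θ * (12 * (1 + δ) * x / n) := by positivity
          linarith
        have h := le_kthLargest_of_card hk hkn hcard.ge hlow
        rw [div_le_iff₀ hn0] at h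
        rw [le_div_iff₀ hθ0]
        linarith
    _ ≤ ∑ v ∈ S, (M.accumulate d θ 0 0).toOuterMeasure (B v) :=
        MeasureTheory.measure_biUnion_finset_le _ _
    _ ≤ ∑ _v ∈ S, ENNReal.ofReal (1 / n) := Finset.sum_le_sum hB
    _ = ENNReal.ofReal (((k : ℝ≥0) / n : ℝ≥0) : ℝ) := by
        rw [Finset.sum_const, hcard, nsmul_eq_mul, ← ENNReal.ofReal_natCast,
          ← ENNReal.ofReal_mul (by positivity)]
        congr 1
        push_cast
        ring
    _ = _ := ENNReal.ofReal_coe_nnreal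

theorem exists_asvRR_time_bound {c ε₀ l₀ : ℝ} (hc : 0 < c) (hε₀ : 0 < ε₀) (hl₀ : 0 < l₀) :
    ∃ C : ℝ, 0 < C ∧
      ∀ (n : ℕ) [NeZero n] (M : TriggeringModel n) (d : Fin n → ℝ≥0) (ε l : ℝ) (k : ℕ),
        2 ≤ n → M.E.Nonempty → (∀ v : Fin n, (d v : ℝ) ≤ c * (M.inDegree v : ℝ)) →
        0 < ε → ε ≤ ε₀ → l₀ ≤ l → 1 ≤ k → k ≤ n →
        ((M.asvRR d ε l k).expect fun r => (r.2 : ℝ≥0∞)) ≤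
          ENNReal.ofReal (C * (l * ((M.E.card : ℝ) + (n : ℝ)) * Real.log n * M.inDegreeSpread
            / (kthLargest k M.shapley * ε ^ 2))) := by
  -- Above `B` times the target, `ψ^(k)` makes the test succeed with high probability.
  set B : ℝ := 12 * (1 + 2 * ε₀) with hB
  have hB12 : 12 ≤ B := by rw [hB]; linarith
  set c₅ := sampleConstant ε₀ l₀ with hc₅
  have hlog2 : 0 < Real.log 2 := Real.log_pos (by norm_num)
  have hc₅0 : 0 < c₅ := by rw [hc₅, sampleConstant]; positivity
  refine ⟨c₅ * (c + 7) * (36 * B + 5), by positivity, ?_⟩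
  intro n _ M d ε l k hn hE hd hε hεε hl hk hkn
  have hl' : 0 < l := hl₀.trans_le hl
  have hn0 : (0 : ℝ) < n := by positivity
  have hn2 : (2 : ℝ) ≤ n := by exact_mod_cast hn
  have hL : 0 < Real.log n := Real.log_pos (by exact_mod_cast hn)
  have hI := M.one_le_inDegreeSpread hE
  set K : ℝ≥0 := ⟨(c + 7) * ((M.E.card + n) / n * M.inDegreeSpread), by positivity⟩ with hKdef
  have hKval : (K : ℝ) = (c + 7) * ((M.E.card + n) / n * M.inDegreeSpread) := rfl
  have hK : M.rrCost d ≤ K := by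
    rw [← ENNReal.ofReal_coe_nnreal]
    exact M.rrCost_le d hc hE hd
  have hK1 : 1 ≤ (K : ℝ) := by
    rw [hKval]
    have h1 : 1 ≤ ((M.E.card : ℝ) + n) / n := by
      rw [le_div_iff₀ hn0, one_mul]
      exact le_add_of_nonneg_left (Nat.cast_nonneg _)
    calc (1 : ℝ) = 1 * (1 * 1) := by norm_num
      _ ≤ _ := by gcongr; linarith
  set Q := l * Real.log n / ε ^ 2 with hQ
  have hQ0 : 0 < Q := by positivity
  have hlogQ : Real.logb 2 n ≤ c₅ * Q := by
    refine (logb_two_le hn hε hεε hl₀ hl).trans ?_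
    rw [hc₅, sampleConstant, add_mul]
    exact le_add_of_nonneg_left (by positivity)
  have hQ1 : 1 ≤ c₅ * Q := (one_le_logb_two hn).trans hlogQ
  set ψ := kthLargest k M.shapley with hψdef
  have hψ0 : 0 < ψ := by
    obtain ⟨u, -, hu⟩ := exists_kthLargest_le_and_le_kthLargest hk hkn M.shapley M.shapley
    exact (M.shapley_pos u).trans_le hu
  have hkψ : k * ψ ≤ n := by
    rw [← M.sum_shapley]
    exact mul_kthLargest_le_sum hk hkn fun v => (M.shapley_pos v).le
  have hk1 : (1 : ℝ) ≤ k := by exact_mod_cast hk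
  have hψn : ψ ≤ n := by nlinarith
  have hkle : (k : ℝ) ≤ n / ψ := by rwa [le_div_iff₀ hψ0]
  obtain ⟨J, hJ⟩ : ∃ J, J = Nat.log 2 n - 1 := ⟨_, rfl⟩
  have hJn : (2 : ℝ) ^ J ≤ n := by
    have : 2 ^ J ≤ n := by rw [hJ]; simpa using two_pow_log_sub_one_le (n := n)
    exact_mod_cast this
  have hJQ : (J : ℝ) ≤ c₅ * Q := by
    refine le_trans (le_trans ?_ (Real.natLog_le_logb n 2)) hlogQ
    rw [hJ]
    exact_mod_cast Nat.sub_le _ _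
  -- The bounds for the three parts of the worst case.
  have hθJ : (phaseOneCount n (Real.sqrt 2 * ε) l J : ℝ) ≤ c₅ * Q * n := by
    rcases Nat.eq_zero_or_pos J with h0 | h0
    · rw [h0]
      simp only [phaseOneCount, if_true, Nat.cast_zero]
      positivity
    · exact (phaseOneCount_le hn hε hεε hl₀ hl h0).trans (by gcongr)
  have hθ1 : (phaseTwoCount n ε l 1 : ℝ) ≤ c₅ * Q * n := by
    simpa using phaseTwoCount_le hn hε hεε hl₀ hl one_pos (by linarith)
  have hJn2 : (J : ℝ) * (n + 2) ≤ 2 * (c₅ * Q * n) * K := by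
    calc (J : ℝ) * (n + 2) ≤ c₅ * Q * (n + n) := by gcongr
      _ = 2 * (c₅ * Q * n) * 1 := by ring
      _ ≤ _ := by gcongr
  have hworst : (phaseOneCount n (Real.sqrt 2 * ε) l J : ℝ) * K + J * (n + 2)
      + 2 * phaseTwoCount n ε l 1 * K ≤ 5 * (c₅ * Q * n) * K := by
    have h1 : (phaseOneCount n (Real.sqrt 2 * ε) l J : ℝ) * K ≤ c₅ * Q * n * K := by gcongr
    have h2 : (phaseTwoCount n ε l 1 : ℝ) * K ≤ c₅ * Q * n * K := by gcongr
    linarith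
  have htarget : c₅ * (c + 7) * (36 * B + 5) * (l * ((M.E.card : ℝ) + (n : ℝ)) * Real.log n
      * M.inDegreeSpread / (ψ * ε ^ 2)) = (36 * B + 5) * (c₅ * Q * K * (n / ψ)) := by
    rw [hKval, hQ]
    field_simp
  rw [htarget]
  by_cases hex : ∃ i, 1 ≤ i ∧ i ≤ J ∧ B * phaseOneTarget n i ≤ ψ
  · -- The first iteration whose target is far below `ψ^(k)`.
    classical
    obtain ⟨hI1, hIJ, hIψ⟩ := Nat.find_spec hex
    have hmin := fun i => Nat.find_min hex (m := i)
    set I := Nat.find hex with hIdef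
    have hpowI : (2 : ℝ) ^ I ≤ 2 * B * (n / ψ) := by
      rw [← mul_div_assoc, le_div_iff₀ hψ0]
      rcases hI1.eq_or_lt with h1 | h1
      · rw [← h1]
        nlinarith
      · have h2 := hmin (I - 1) (by omega)
        have h3 : ψ < B * phaseOneTarget n (I - 1) := by
          by_contra! h
          exact h2 ⟨by omega, by omega, h⟩
        have h4 : (2 : ℝ) ^ I = 2 * 2 ^ (I - 1) := by
          rw [← pow_succ', Nat.sub_add_cancel hI1]
        rw [phaseOneTarget, ← mul_div_assoc, lt_div_iff₀ (by positivity)] at h3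
        rw [h4]
        linarith
    have hδB : 12 * (1 + Real.sqrt 2 * ε) ≤ B := by
      have hsq : Real.sqrt 2 ≤ 2 := by
        rw [Real.sqrt_le_left (by norm_num)]; norm_num
      have : Real.sqrt 2 * ε ≤ 2 * ε₀ := by gcongr
      rw [hB]
      linarith
    have hx0 := phaseOneTarget_pos (show 1 ≤ n by omega) I
    have hxn : phaseOneTarget n I ≤ n := by
      rw [phaseOneTarget]
      exact div_le_self hn0.le (one_le_pow₀ one_le_two)
    have hp := M.accumulate_test_fails_le d hn (sqrt_two_mul_pos hε) hl' hk hkn hI1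
      (le_trans (by gcongr) hIψ)
    set a : ℝ≥0 := ⟨4 * (c₅ * Q * K), by positivity⟩ with ha
    have haval : (a : ℝ) = 4 * (c₅ * Q * K) := rfl
    refine (M.expect_asvRR_time_le_of_test d hn hε hl' k hI1 hIJ hJ (a := a) hK ?_ hp).trans ?_
    · intro i hi
      rw [← NNReal.coe_le_coe]
      push_cast
      rw [haval]
      have h1 : (phaseOneCount n (Real.sqrt 2 * ε) l i : ℝ) * K ≤ c₅ * Q * 2 ^ i * K := by
        gcongr
        exact phaseOneCount_le hn hε hεε hl₀ hl hi
      have h2 : (1 : ℝ) ≤ 2 ^ i := one_le_pow₀ one_le_two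
      have h3 : 1 * 1 * 1 ≤ c₅ * Q * 2 ^ i * K := by gcongr
      linarith
    · rw [← ENNReal.ofReal_coe_nnreal]
      refine ENNReal.ofReal_le_ofReal ?_
      push_cast
      rw [haval]
      have h1 : (phaseTwoCount n ε l (phaseOneTarget n I) : ℝ) * K
          ≤ c₅ * Q * 2 ^ I * K := by
        gcongr
        refine (phaseTwoCount_le hn hε hεε hl₀ hl hx0 hxn).trans (le_of_eq ?_)
        rw [phaseOneTarget, div_div_cancel₀ hn0.ne']
      have h2 : (1 : ℝ) ≤ 2 ^ I := one_le_pow₀ one_le_two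
      have h3 : 1 * 1 * 1 ≤ c₅ * Q * 2 ^ I * K := by gcongr
      have h4 : (k : ℝ) / n * ((phaseOneCount n (Real.sqrt 2 * ε) l J : ℝ) * K + J * (n + 2)
          + 2 * phaseTwoCount n ε l 1 * K) ≤ 5 * (c₅ * Q * K * (n / ψ)) := by
        calc _ ≤ (k : ℝ) / n * (5 * (c₅ * Q * n) * K) := by gcongr
          _ = 5 * (c₅ * Q * K * k) := by field_simp
          _ ≤ _ := by gcongr
      have h5 : c₅ * Q * 2 ^ I * K ≤ 2 * B * (c₅ * Q * K * (n / ψ)) := by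
        calc c₅ * Q * 2 ^ I * K ≤ c₅ * Q * (2 * B * (n / ψ)) * K := by gcongr
          _ = _ := by ring
      have h6 : 0 ≤ B * (c₅ * Q * K * (n / ψ)) := by positivity
      rw [pow_succ]
      linarith
  · -- No target is far below `ψ^(k)`, which therefore is bounded.
    have hψB : ψ ≤ 4 * B := by
      rcases Nat.eq_zero_or_pos J with h0 | h0
      · have h1 : n < 2 ^ (Nat.log 2 n + 1) := Nat.lt_pow_succ_log_self (by norm_num) n
        have h2 : 2 ^ (Nat.log 2 n + 1) ≤ 2 ^ 2 := Nat.pow_le_pow_right two_pos (by omega)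
        have h3 : (n : ℝ) ≤ 4 := by exact_mod_cast (h1.le.trans h2)
        linarith
      · have h1 : ψ < B * phaseOneTarget n J := by
          by_contra! h
          exact hex ⟨J, h0, le_rfl, h⟩
        have h2 : n < 2 ^ (Nat.log 2 n + 1) := Nat.lt_pow_succ_log_self (by norm_num) n
        rw [show Nat.log 2 n + 1 = J + 2 by omega, pow_add] at h2
        have h3 : (n : ℝ) ≤ 4 * 2 ^ J := by
          have : n ≤ 4 * 2 ^ J := by omega
          exact_mod_cast this
        have h4 : phaseOneTarget n J ≤ 4 := by
          rw [phaseOneTarget, div_le_iff₀ (by positivity)]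
          exact h3
        have h5 : B * phaseOneTarget n J ≤ B * 4 := by gcongr
        linarith
    refine (M.expect_asvRR_time_le_worst d hn hε hl' k hJ hK).trans ?_
    rw [← ENNReal.ofReal_coe_nnreal]
    refine ENNReal.ofReal_le_ofReal ?_
    push_cast
    have h1 : 1 * 1 * 1 ≤ c₅ * Q * n * K := by
      gcongr
      linarith
    have h2 : c₅ * Q * n * K ≤ 4 * B * (c₅ * Q * K * (n / ψ)) := by
      have h3 : 1 ≤ 4 * B / ψ := (one_le_div hψ0).2 hψB
      calc c₅ * Q * n * K = c₅ * Q * n * K * 1 := by ring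
        _ ≤ c₅ * Q * n * K * (4 * B / ψ) := by gcongr
        _ = _ := by ring
    have h6 : 0 ≤ c₅ * Q * K * (n / ψ) := by positivity
    linarith

end TriggeringModel

theorem theorem3 :
    (∀ (n : ℕ) [NeZero n] (M : TriggeringModel n) (drawTime : Fin n → ℝ≥0) (ε l : ℝ) (k : ℕ),
      0 < ε → 0 < l → 1 ≤ k → k ≤ n →
      -- unbiasedness
      (∀ v : Fin n,
        HasSum (fun r => (M.asvRR drawTime ε l k r).toReal * r.1 v) (M.shapley v)) ∧
      -- absolute normalization in every run
      (∀ r ∈ (M.asvRR drawTime ε l k).support, ∑ v, r.1 v = (n : ℝ)) ∧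
      -- robustness
      (1 ≤ kthLargest k M.shapley →
        ENNReal.ofReal (1 - 1 / (n : ℝ) ^ l) ≤
          (M.asvRR drawTime ε l k).toOuterMeasure
            {r | ∀ v : Fin n,
              (kthLargest k M.shapley < M.shapley v →
                |r.1 v - M.shapley v| ≤ ε * M.shapley v) ∧
              (M.shapley v ≤ kthLargest k M.shapley →
                |r.1 v - M.shapley v| ≤ ε * kthLargest k M.shapley)})) ∧
    -- expected running time
    (∀ c ε₀ l₀ : ℝ, 0 < c → 0 < ε₀ → 0 < l₀ →
      ∃ C : ℝ, 0 < C ∧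
        ∀ (n : ℕ) [NeZero n] (M : TriggeringModel n) (drawTime : Fin n → ℝ≥0) (ε l : ℝ) (k : ℕ),
          2 ≤ n → M.E.Nonempty →
          (∀ v : Fin n, (drawTime v : ℝ) ≤ c * (M.inDegree v : ℝ)) →
          0 < ε → ε ≤ ε₀ → l₀ ≤ l → 1 ≤ k → k ≤ n →
          (Real.logb 2 k - Real.logb 2 (Real.logb 2 n)) / Real.logb 2 n ≤ l →
          ∑' r, M.asvRR drawTime ε l k r * (r.2 : ℝ≥0∞) ≤
            ENNReal.ofReal (C * (l * ((M.E.card : ℝ) + (n : ℝ)) * Real.log n * M.inDegreeSpread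
              / (kthLargest k M.shapley * ε ^ 2)))) := by
  refine ⟨fun n _ M d ε l k hε hl hk hkn => ⟨M.hasSum_asvRR d hε hl k,
    fun r hr => M.sum_eq_of_mem_support_asvRR d hε hl k hr, M.asvRR_robust d hε hl hk hkn⟩,
    fun c ε₀ l₀ hc hε₀ hl₀ => ?_⟩
  obtain ⟨C, hC, h⟩ := TriggeringModel.exists_asvRR_time_bound hc hε₀ hl₀
  exact ⟨C, hC, fun n _ M d ε l k hn hE hd hε hεε hl hk hkn _ =>
    h n M d ε l k hn hE hd hε hεε hl hk hkn⟩
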